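/- Throughout, let $D$ be an integral domain with quotient field $K$. Call $D$ **treed** if any two prime ideals of $D$ contained in a common maximal ideal are comparable under inclusion. An ideal $I$ of $D$ is a **valuation ideal** if $IV\cap D=I$ for some valuation domain $V$ with $D\subseteq V\subseteq K$, and it is **invertible** if $II^{-1}=D$, where $I^{-1}=\{x\in K : xI\subseteq D\}$. $D$ is a **Prüfer domain** if every nonzero finitely generated ideal of $D$ is invertible, and $D$ is **h-local** if every nonzero nonunit of $D$ lies in only finitely many maximal ideals and every nonzero prime ideal of $D$ is contained in a unique maximal ideal. $D$ is a **VIFD** if every nonzero principal ideal of $D$ is a finite product of valuation ideals. An integral domain $R$ is a **VFD** if every nonzero nonunit of $R$ is a finite product of valuation elements, i.e. of nonzero nonunits $a$ for which $aR$ is a valuation ideal of $R$. Finite products and intersections have at least one factor, and a family of ideals $I_1,\dots,I_n$ is **comaximal** if $I_i+I_j=D$ for all $i\neq j$. For an integral domain $R$ with quotient field $L$ and a nonzero fractional ideal $A$ of $R$ let $A^{-1}=\{x\in L: xA\subseteq R\}$, $A_v=(A^{-1})^{-1}$ and $A_t=\bigcup\{J_v : J\subseteq A \text{ a nonzero finitely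 generated fractional ideal}\}$. A **$t$-ideal** of $R$ is a nonzero ideal $I$ of $R$ with $I_t=I$, and a **maximal $t$-ideal** is a maximal element of the set of proper $t$-ideals. $D$ is a **UMT-domain** if every nonzero prime ideal $Q$ of $D[X]$ with $Q\cap D=(0)$ is a maximal $t$-ideal of $D[X]$. For $g\in D[X]$ let $c(g)$ be the ideal of $D$ generated by the coefficients of $g$; the **Nagata ring** of $D$ is $D(X)=\{f/g : f,g\in D[X],\ c(g)=D\}$. **Corollary 4.7.** Let $D$ be a treed domain. The following statements are equivalent. 1. $D$ is an h-local Prüfer domain. 2. $D$ is a VIFD. 3. Every nonzero ideal of $D$ is a finite product of valuation ideals. 4. Every nonzero principal ideal of $D$ can be written as a finite product of comaximal valuation ideals. 5. Every nonzero principal ideal of $D$ can be written as a finite intersection of comaximal valuation ideals. 6. Every nonzero prime ideal of $D$ contains an invertible valuation ideal. 7. $D(X)$ is a VFD and $D$ is a UMT-domain. -/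

import Mathlib

open Polynomial
open scoped nonZeroDivisors

noncomputable section

/-- `D` is treed: any two prime ideals contained in a common maximal ideal are comparable. -/
def IsTreedDomain (D : Type*) [CommRing D] [IsDomain D] : Prop :=
  ∀ M P Q : Ideal D, M.IsMaximal → P.IsPrime → Q.IsPrime → P ≤ M → Q ≤ M → P ≤ Q ∨ Q ≤ P

/-- `D` is h-local: every nonzero nonunit lies in only finitely many maximal ideals, and every
nonzero prime ideal is contained in a unique maximal ideal. -/
def IsHLocalDomain (D : Type*) [CommRing D] [IsDomain D] : Prop :=
  (∀ a : D, a ≠ 0 → ¬ IsUnit a → {M : Ideal D | M.IsMaximal ∧ a ∈ M}.Finite) ∧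
  (∀ P : Ideal D, P.IsPrime → P ≠ ⊥ → ∃! M : Ideal D, M.IsMaximal ∧ P ≤ M)

/-- The ideal `I` is invertible: `I I⁻¹ = D`, where `I⁻¹ = (D : I)` is computed in the
quotient field. -/
def IsInvertibleIdeal {D : Type*} [CommRing D] [IsDomain D] (I : Ideal D) : Prop :=
  (I : FractionalIdeal D⁰ (FractionRing D)) * (I : FractionalIdeal D⁰ (FractionRing D))⁻¹ = 1

/-- Prüfer domain: every nonzero finitely generated ideal is invertible. -/
def IsPruferDomain (D : Type*) [CommRing D] [IsDomain D] : Prop :=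
  ∀ I : Ideal D, I ≠ ⊥ → I.FG → IsInvertibleIdeal I

/-- The ideal `I` is a valuation ideal: `IV ∩ D = I` for some valuation overring `V` of `D`,
that is, a valuation subring `V` of the quotient field that contains `D`. -/
def IsValuationIdeal {D : Type*} [CommRing D] [IsDomain D] (I : Ideal D) : Prop :=
  ∃ (V : ValuationSubring (FractionRing D)) (h : ∀ d : D, algebraMap D (FractionRing D) d ∈ V),
    (I.map ((algebraMap D (FractionRing D)).codRestrict V h)).comap
      ((algebraMap D (FractionRing D)).codRestrict V h) = I

/-- A valuation element: a nonzero nonunit generating a valuation ideal. -/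
def IsValuationElement {D : Type*} [CommRing D] [IsDomain D] (a : D) : Prop :=
  a ≠ 0 ∧ ¬ IsUnit a ∧ IsValuationIdeal (Ideal.span {a})

/-- `J` is a product of finitely many (at least one) valuation ideals. -/
def IsProductOfValuationIdeals {D : Type*} [CommRing D] [IsDomain D] (J : Ideal D) : Prop :=
  ∃ (n : ℕ) (I : Fin n → Ideal D), 0 < n ∧ (∀ i, IsValuationIdeal (I i)) ∧ J = ∏ i, I i

/-- `J` is a product of finitely many pairwise comaximal valuation ideals. -/
def IsProductOfComaximalValuationIdeals {D : Type*} [CommRing D] [IsDomain D]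
    (J : Ideal D) : Prop :=
  ∃ (n : ℕ) (I : Fin n → Ideal D), 0 < n ∧ (∀ i, IsValuationIdeal (I i)) ∧
    (∀ i j, i ≠ j → I i ⊔ I j = ⊤) ∧ J = ∏ i, I i

/-- `J` is an intersection of finitely many pairwise comaximal valuation ideals. -/
def IsIntersectionOfComaximalValuationIdeals {D : Type*} [CommRing D] [IsDomain D]
    (J : Ideal D) : Prop :=
  ∃ (n : ℕ) (I : Fin n → Ideal D), 0 < n ∧ (∀ i, IsValuationIdeal (I i)) ∧
    (∀ i j, i ≠ j → I i ⊔ I j = ⊤) ∧ J = ⨅ i, I i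

/-- Valuation ideal factorization domain. -/
def IsVIFD (D : Type*) [CommRing D] [IsDomain D] : Prop :=
  ∀ a : D, a ≠ 0 → IsProductOfValuationIdeals (Ideal.span {a})

/-- Valuation factorization domain: every nonzero nonunit is a product of finitely many
(at least one) valuation elements. -/
def IsVFD (D : Type*) [CommRing D] [IsDomain D] : Prop :=
  ∀ a : D, a ≠ 0 → ¬ IsUnit a →
    ∃ (n : ℕ) (v : Fin n → D), 0 < n ∧ (∀ i, IsValuationElement (v i)) ∧ a = ∏ i, v i

/-- `A_v = (A⁻¹)⁻¹`. -/
def vClosure {R : Type*} [CommRing R] [IsDomain R] (A : FractionalIdeal R⁰ (FractionRing R)) :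
    FractionalIdeal R⁰ (FractionRing R) :=
  (A⁻¹)⁻¹

/-- `A_t`: the union of the `J_v` over all nonzero finitely generated fractional ideals
`J ⊆ A`. -/
def tClosure {R : Type*} [CommRing R] [IsDomain R] (A : FractionalIdeal R⁰ (FractionRing R)) :
    Set (FractionRing R) :=
  {x | ∃ J : FractionalIdeal R⁰ (FractionRing R), J ≠ 0 ∧
    (J : Submodule R (FractionRing R)).FG ∧ J ≤ A ∧ x ∈ vClosure J}

/-- A (nonzero, integral) `t`-ideal: a nonzero ideal `I` with `I_t = I`. -/
def IsTIdeal {R : Type*} [CommRing R] [IsDomain R] (I : Ideal R) : Prop :=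
  I ≠ ⊥ ∧ tClosure (I : FractionalIdeal R⁰ (FractionRing R)) =
    {x | x ∈ (I : FractionalIdeal R⁰ (FractionRing R))}

/-- A maximal `t`-ideal: a maximal element of the set of proper `t`-ideals. -/
def IsMaximalTIdeal {R : Type*} [CommRing R] [IsDomain R] (M : Ideal R) : Prop :=
  Maximal (fun I : Ideal R => IsTIdeal I ∧ I ≠ ⊤) M

/-- UMT-domain: every upper to zero in `D[X]` (a nonzero prime ideal `Q` with `Q ∩ D = 0`) is a
maximal `t`-ideal of `D[X]`. -/
def IsUMTDomain (D : Type*) [CommRing D] [IsDomain D] : Prop :=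
  ∀ Q : Ideal D[X], Q.IsPrime → Q ≠ ⊥ → Q.comap (C : D →+* D[X]) = ⊥ → IsMaximalTIdeal Q

/-- The multiplicative set of polynomials whose coefficients generate the unit ideal. -/
def unitContentSubmonoid (D : Type*) [CommRing D] : Submonoid D[X] where
  carrier := {g | g.contentIdeal = ⊤}
  one_mem' := by simp
  mul_mem' := fun hf hg => contentIdeal_mul_eq_top_of_contentIdeal_eq_top hf hg

theorem unitContentSubmonoid_le_nonZeroDivisors (D : Type*) [CommRing D] [IsDomain D] :
    unitContentSubmonoid D ≤ D[X]⁰ := by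
  intro g hg
  rw [mem_nonZeroDivisors_iff_ne_zero]
  rintro rfl
  have h : (0 : D[X]).contentIdeal = ⊤ := hg
  rw [contentIdeal_zero] at h
  exact bot_ne_top h

/-- The Nagata ring `D(X)`: the ring of fractions `f / g` with `f, g ∈ D[X]` and
`c(g) = D`. -/
abbrev NagataRing (D : Type*) [CommRing D] : Type _ :=
  Localization (unitContentSubmonoid D)

instance NagataRing.instIsDomain (D : Type*) [CommRing D] [IsDomain D] :
    IsDomain (NagataRing D) :=
  IsLocalization.isDomain_localization (unitContentSubmonoid_le_nonZeroDivisors D)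

end

/-! ### Ideals below a principal ideal; extension to a valuation ring -/

noncomputable section

/-! The hub is the condition that every nonzero prime contains an invertible valuation ideal.
Suppose neither of x, y divides the other in D_M. Treedness yields one nonzero prime P ≤ M that
lies, locally at M, in the radicals of both (y) : x and (x) : y
(`IsTreedDomain.exists_prime_forall_fg`). Let I ≤ P be invertible with IV ∩ D = I, and say x/y ∈ V.
Then s x Iⁿ ⊆ yD for some s ∉ M, and I can be cancelled n times
(`IsContractedFrom.dvd_mul_of_forall_mem_pow`), so y divides s x, a contradiction. Hence every D_M
is a valuation domain and D is Prüfer.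

In a Prüfer domain an invertible valuation ideal lies in at most one maximal ideal
(`IsPruferDomain.eq_of_isInvertibleIdeal_of_le`). This separates the maximal ideals over a nonzero
prime; since each nonzero principal ideal contains a finite product of such ideals, it also gives
finite character.

Conversely, over an h-local Prüfer domain a nonzero proper ideal J is the intersection, hence the
product, of the finitely many comaximal valuation ideals J D_M ∩ D with M ⊇ J. Factors of a nonzero
principal ideal are invertible, and a prime above a product contains a factor, which leads back to
the hub.

For Prüfer D an ideal of D(X) is determined by its constants, so D(X) is Bézout and inherits
h-locality; the comaximal factors of a principal ideal are then principal. In the other direction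
the cancellation is run inside D(X) with a valuation element f whose content lies in P, and c(f) is
the required ideal of D. -/

theorem Ideal.exists_eq_span_singleton_mul_of_le {R : Type*} [CommRing R] {A : Ideal R} {c : R}
    (h : A ≤ Ideal.span {c}) : ∃ B : Ideal R, A = Ideal.span {c} * B := by
  refine ⟨Submodule.comap (LinearMap.mulLeft R c) A, le_antisymm ?_ ?_⟩
  · intro a ha
    obtain ⟨b, rfl⟩ := Ideal.mem_span_singleton'.1 (h ha)
    exact Ideal.mem_span_singleton_mul.2 ⟨b, by simpa [mul_comm] using ha, mul_comm _ _⟩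
  · intro a ha
    obtain ⟨b, hb, rfl⟩ := Ideal.mem_span_singleton_mul.1 ha
    simpa using hb

theorem Ideal.mem_map_iff_exists_dvd {R V : Type*} [CommRing R] [CommRing V]
    [IsDomain V] [ValuationRing V] (φ : R →+* V) (I : Ideal R) (x : V) :
    x ∈ I.map φ ↔ ∃ i ∈ I, φ i ∣ x := by
  constructor
  · intro hx
    induction hx using Submodule.span_induction with
    | mem x hx =>
      obtain ⟨i, hi, rfl⟩ := hx
      exact ⟨i, hi, dvd_rfl⟩
    | zero => exact ⟨0, I.zero_mem, by simp⟩
    | add x y _ _ hx hy =>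
      obtain ⟨i, hi, hix⟩ := hx
      obtain ⟨j, hj, hjy⟩ := hy
      rcases ValuationRing.dvd_total (φ i) (φ j) with h | h
      · exact ⟨i, hi, dvd_add hix (h.trans hjy)⟩
      · exact ⟨j, hj, dvd_add (h.trans hix) hjy⟩
    | smul a x _ hx =>
      obtain ⟨i, hi, hix⟩ := hx
      exact ⟨i, hi, hix.mul_left a⟩
  · rintro ⟨i, hi, v, rfl⟩
    exact Ideal.mul_mem_right _ _ (Ideal.mem_map_of_mem φ hi)

/-! ### Invertible ideals and cancellation -/

section Invertible

variable {R : Type*} [CommRing R] [IsDomain R] {I : Ideal R}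

theorem isInvertibleIdeal_iff_exists_mul_eq_span :
    IsInvertibleIdeal I ↔ ∃ (B : Ideal R) (c : R), c ≠ 0 ∧ I * B = Ideal.span {c} := by
  unfold IsInvertibleIdeal
  rw [FractionalIdeal.mul_inv_cancel_iff]
  constructor
  · rintro ⟨J, hJ⟩
    obtain ⟨a, B, ha, rfl⟩ := FractionalIdeal.exists_eq_spanSingleton_mul J
    refine ⟨B, a, ha, ?_⟩
    have ha' : algebraMap R (FractionRing R) a ≠ 0 := by simpa using ha
    rw [← FractionalIdeal.coeIdeal_inj (K := FractionRing R), FractionalIdeal.coeIdeal_mul,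
      FractionalIdeal.coeIdeal_span_singleton]
    calc _ = FractionalIdeal.spanSingleton R⁰ (algebraMap R (FractionRing R) a) *
          ((I : FractionalIdeal R⁰ (FractionRing R)) *
          (FractionalIdeal.spanSingleton R⁰ (algebraMap R (FractionRing R) a)⁻¹ * B)) := by
            rw [mul_left_comm (I : FractionalIdeal R⁰ (FractionRing R)), ← mul_assoc,
              FractionalIdeal.spanSingleton_mul_spanSingleton, mul_inv_cancel₀ ha']
            simp
      _ = _ := by rw [hJ, mul_one]
  · rintro ⟨B, c, hc, h⟩
    have hc' : algebraMap R (FractionRing R) c ≠ 0 := by simpa using hc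
    refine ⟨B * FractionalIdeal.spanSingleton R⁰ (algebraMap R (FractionRing R) c)⁻¹, ?_⟩
    rw [← mul_assoc, ← FractionalIdeal.coeIdeal_mul, h, FractionalIdeal.coeIdeal_span_singleton,
      FractionalIdeal.spanSingleton_mul_spanSingleton, mul_inv_cancel₀ hc']
    simp

theorem isInvertibleIdeal_span_singleton {c : R} (hc : c ≠ 0) :
    IsInvertibleIdeal (Ideal.span {c}) :=
  isInvertibleIdeal_iff_exists_mul_eq_span.2 ⟨⊤, c, hc, by simp⟩

namespace IsInvertibleIdeal

theorem exists_mul_eq_span (hI : IsInvertibleIdeal I) {c : R} (hc : c ∈ I) :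
    ∃ B : Ideal R, I * B = Ideal.span {c} := by
  obtain ⟨B₀, c₀, hc₀, h⟩ := isInvertibleIdeal_iff_exists_mul_eq_span.1 hI
  have hle : Ideal.span {c} * B₀ ≤ Ideal.span {c₀} := by
    rw [← h]
    exact Ideal.mul_mono_left ((Ideal.span_singleton_le_iff_mem _).2 hc)
  obtain ⟨B, hB⟩ := Ideal.exists_eq_span_singleton_mul_of_le hle
  refine ⟨B, ?_⟩
  rw [← Ideal.span_singleton_mul_right_inj hc₀, mul_left_comm, ← hB, mul_left_comm, h, mul_comm]

theorem le_of_mul_le_mul (hI : IsInvertibleIdeal I) {A C : Ideal R} (h : A * I ≤ C * I) :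
    A ≤ C := by
  obtain ⟨B, c, hc, hB⟩ := isInvertibleIdeal_iff_exists_mul_eq_span.1 hI
  have h2 : A * I * B ≤ C * I * B := Ideal.mul_mono_left h
  rw [mul_assoc, mul_assoc, hB] at h2
  exact (Ideal.span_singleton_mul_left_mono hc).1 h2

theorem of_mul_left {A : Ideal R} (h : IsInvertibleIdeal (I * A)) : IsInvertibleIdeal I := by
  obtain ⟨B, c, hc, hB⟩ := isInvertibleIdeal_iff_exists_mul_eq_span.1 h
  exact isInvertibleIdeal_iff_exists_mul_eq_span.2 ⟨A * B, c, hc, by rw [← mul_assoc, hB]⟩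

theorem of_dvd {A : Ideal R} (h : IsInvertibleIdeal A) (hd : I ∣ A) : IsInvertibleIdeal I := by
  obtain ⟨B, rfl⟩ := hd
  exact h.of_mul_left

theorem ne_bot (hI : IsInvertibleIdeal I) : I ≠ ⊥ := by
  rintro rfl
  obtain ⟨B, c, hc, h⟩ := isInvertibleIdeal_iff_exists_mul_eq_span.1 hI
  rw [Ideal.bot_mul, eq_comm, Ideal.span_singleton_eq_bot] at h
  exact hc h

theorem fg (hI : IsInvertibleIdeal I) : I.FG :=
  Ideal.fg_of_isUnit (S := R⁰) (P := FractionRing R)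
    (IsFractionRing.injective R (FractionRing R)) I
    (FractionalIdeal.mul_inv_cancel_iff_isUnit _ |>.1 hI)

end IsInvertibleIdeal

end Invertible

/-! ### Valuation ideals in terms of elements -/

section Valuation

variable {R : Type*} [CommRing R] [IsDomain R]

/-- `V` is an overring of `R` with `IV ∩ R ⊆ I`. -/
def IsContractedFrom (I : Ideal R) (V : ValuationSubring (FractionRing R)) : Prop :=
  (∀ d : R, algebraMap R (FractionRing R) d ∈ V) ∧
    ∀ i ∈ I, ∀ d : R, ∀ v ∈ V,
      algebraMap R (FractionRing R) d = algebraMap R (FractionRing R) i * v → d ∈ I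

theorem isValuationIdeal_iff {I : Ideal R} :
    IsValuationIdeal I ↔ ∃ V : ValuationSubring (FractionRing R), IsContractedFrom I V := by
  constructor
  · rintro ⟨V, h, hI⟩
    refine ⟨V, h, fun i hi d v hv hd => ?_⟩
    rw [← hI, Ideal.mem_comap, Ideal.mem_map_iff_exists_dvd]
    exact ⟨i, hi, ⟨v, hv⟩, Subtype.ext hd⟩
  · rintro ⟨V, h, hI⟩
    refine ⟨V, h, le_antisymm (fun d hd => ?_) Ideal.le_comap_map⟩
    rw [Ideal.mem_comap, Ideal.mem_map_iff_exists_dvd] at hd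
    obtain ⟨i, hi, v, hv⟩ := hd
    exact hI i hi d v v.2 (congrArg Subtype.val hv)

theorem isValuationIdeal_top : IsValuationIdeal (⊤ : Ideal R) :=
  isValuationIdeal_iff.2 ⟨⊤, fun _ => trivial, fun _ _ _ _ _ _ => trivial⟩

/-- Descending induction on powers of an invertible valuation ideal. -/
theorem IsContractedFrom.dvd_mul_of_forall_mem_pow {I : Ideal R}
    {V : ValuationSubring (FractionRing R)} (hV : IsContractedFrom I V) (hI : IsInvertibleIdeal I)
    {x y s : R} {z : FractionRing R} (hz : z ∈ V)
    (hxy : algebraMap R (FractionRing R) x = algebraMap R (FractionRing R) y * z) (hy : y ≠ 0)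
    {n : ℕ} (h : ∀ e ∈ I ^ n, y ∣ s * x * e) : y ∣ s * x := by
  induction n with
  | zero => simpa using h 1 (by simp)
  | succ n ih =>
    refine ih fun e he => ?_
    have hle : Ideal.span {s * x * e} * I ≤ Ideal.span {y} * I := by
      intro w hw
      obtain ⟨i, hi, rfl⟩ := Ideal.mem_span_singleton_mul.1 hw
      obtain ⟨t, ht⟩ := h (e * i) (by rw [pow_succ]; exact Ideal.mul_mem_mul he hi)
      refine Ideal.mem_span_singleton_mul.2 ⟨t, ?_, by rw [← ht]; ring⟩
      -- The quotient t = s x e i / y equals i · (s z e) with s z e ∈ V, so t ∈ IV ∩ R = I. Thus s x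
      -- e I ⊆ y I, and I cancels.
      refine hV.2 i hi t (algebraMap R _ s * z * algebraMap R _ e)
        (V.mul_mem _ _ (V.mul_mem _ _ (hV.1 s) hz) (hV.1 e)) ?_
      have hy' : algebraMap R (FractionRing R) y ≠ 0 := by simpa using hy
      apply mul_left_cancel₀ hy'
      have := congrArg (algebraMap R (FractionRing R)) ht
      simp only [map_mul] at this
      rw [← this, hxy]
      ring
    have := hI.le_of_mul_le_mul hle
    rwa [Ideal.span_singleton_le_span_singleton] at this

end Valuation

/-! ### Prüfer domains as the domains that are locally valuation domains -/

theorem Ideal.FG.exists_notMem_forall_dvd {D : Type*} [CommRing D] {M : Ideal D} (hM : M.IsPrime)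
    (h : ∀ x y : D, ∃ s ∉ M, y ∣ s * x ∨ x ∣ s * y) {I : Ideal D} (hI : I.FG) :
    ∃ x ∈ I, ∃ s ∉ M, ∀ i ∈ I, x ∣ s * i := by
  induction I, hI using Submodule.fg_induction with
  | singleton x =>
    refine ⟨x, Submodule.mem_span_singleton_self x, 1,
      fun h1 => hM.ne_top ((Ideal.eq_top_iff_one M).2 h1), fun i hi => ?_⟩
    rw [one_mul]
    exact Ideal.mem_span_singleton.1 hi
  | sup I J hI hJ ihI ihJ =>
    obtain ⟨x, hx, s, hs, hxs⟩ := ihI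
    obtain ⟨y, hy, t, ht, hyt⟩ := ihJ
    obtain ⟨r, hr, hxy⟩ := h x y
    have hrst : r * s * t ∉ M := fun hmem =>
      (hM.mem_or_mem hmem).elim (fun h => (hM.mem_or_mem h).elim hr hs) ht
    rcases hxy with ⟨c, hc⟩ | ⟨c, hc⟩
    · refine ⟨y, Submodule.mem_sup_right hy, r * s * t, hrst, fun i hi => ?_⟩
      obtain ⟨a, ha, b, hb, rfl⟩ := Submodule.mem_sup.1 hi
      obtain ⟨a', ha'⟩ := hxs a ha
      obtain ⟨b', hb'⟩ := hyt b hb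
      exact ⟨t * c * a' + r * s * b', by linear_combination r * t * ha' + r * s * hb' + t * a' * hc⟩
    · refine ⟨x, Submodule.mem_sup_left hx, r * s * t, hrst, fun i hi => ?_⟩
      obtain ⟨a, ha, b, hb, rfl⟩ := Submodule.mem_sup.1 hi
      obtain ⟨a', ha'⟩ := hxs a ha
      obtain ⟨b', hb'⟩ := hyt b hb
      exact ⟨r * t * a' + s * c * b', by linear_combination r * t * ha' + r * s * hb' + s * b' * hc⟩

section Pruefer

variable {D : Type*} [CommRing D] [IsDomain D]

/-- Writing (x, y) B = (y) gives y = x p + y q with p, q ∈ B and x p = y p'. Hence p' + q = 1, and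
whichever of p', q lies outside M is the denominator s. -/
theorem IsPruferDomain.exists_dvd_or_dvd (h : IsPruferDomain D) (M : Ideal D) [hM : M.IsPrime]
    (x y : D) : ∃ s ∉ M, y ∣ s * x ∨ x ∣ s * y := by
  by_cases hy : y = 0
  · subst hy
    exact ⟨1, fun h1 => hM.ne_top ((Ideal.eq_top_iff_one M).2 h1), Or.inr (by simp)⟩
  have hne : Ideal.span {x, y} ≠ (⊥ : Ideal D) := by
    intro h0
    have hyI : y ∈ Ideal.span {x, y} := Ideal.subset_span (by simp)
    rw [h0] at hyI
    exact hy hyI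
  have hinv := h _ hne (Submodule.fg_span (Set.toFinite _))
  obtain ⟨B, hB⟩ := hinv.exists_mul_eq_span
    (Ideal.subset_span (by simp : y ∈ ({x, y} : Set D)))
  have hyB : y ∈ Ideal.span {x, y} * B := by rw [hB]; exact Ideal.mem_span_singleton_self y
  have hxb : ∀ b ∈ B, y ∣ x * b := fun b hb => by
    rw [← Ideal.mem_span_singleton, ← hB]
    exact Ideal.mul_mem_mul (Ideal.subset_span (by simp)) hb
  rw [Ideal.span_insert, Ideal.sup_mul] at hyB
  obtain ⟨u, hu, w, hw, huw⟩ := Submodule.mem_sup.1 hyB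
  obtain ⟨p, hp, rfl⟩ := Ideal.mem_span_singleton_mul.1 hu
  obtain ⟨q, hq, rfl⟩ := Ideal.mem_span_singleton_mul.1 hw
  obtain ⟨p', hp'⟩ := hxb p hp
  have h1 : p' + q = 1 := by
    apply mul_left_cancel₀ hy
    rw [mul_add, ← hp', huw, mul_one]
  by_cases hqM : q ∈ M
  · refine ⟨p', fun hpM => hM.ne_top ((Ideal.eq_top_iff_one M).2 (h1 ▸ M.add_mem hpM hqM)),
      Or.inr ⟨p, by rw [hp', mul_comm]⟩⟩
  · exact ⟨q, hqM, Or.inl (by rw [mul_comm]; exact hxb q hq)⟩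

theorem isPruferDomain_of_forall_isMaximal
    (h : ∀ M : Ideal D, M.IsMaximal → ∀ x y : D, ∃ s ∉ M, y ∣ s * x ∨ x ∣ s * y) :
    IsPruferDomain D := by
  intro I hI hfg
  obtain ⟨c, hc, hc0⟩ := Submodule.exists_mem_ne_zero_of_ne_bot hI
  let B : Ideal D := (Ideal.span {c}).colon (I : Set D)
  have hB : ∀ b, b ∈ B ↔ ∀ i ∈ I, c ∣ b * i := fun b => by
    simp only [B, Submodule.mem_colon, SetLike.mem_coe, Ideal.mem_span_singleton, smul_eq_mul]
  refine isInvertibleIdeal_iff_exists_mul_eq_span.2 ⟨B, c, hc0, le_antisymm ?_ ?_⟩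
  · rw [Ideal.mul_le]
    intro i hi b hb
    rw [Ideal.mem_span_singleton, mul_comm]
    exact (hB b).1 hb i hi
  · rw [Ideal.span_singleton_le_iff_mem]
    -- E collects the denominators that bring c into I B. It lies in no maximal ideal M: at M the
    -- ideal I is generated by one of its elements x, so s c = x b with s ∉ M, and this b is in B.
    let E : Ideal D := (I * B).colon {c}
    have hE : ∀ s, s ∈ E ↔ s * c ∈ I * B := fun s => Submodule.mem_colon_singleton
    suffices hEtop : E = ⊤ by
      simpa using (hE 1).1 (hEtop ▸ Submodule.mem_top)
    by_contra hne
    obtain ⟨M, hM, hEM⟩ := Ideal.exists_le_maximal E hne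
    obtain ⟨x, hx, s, hs, hxs⟩ := hfg.exists_notMem_forall_dvd hM.isPrime (h M hM)
    refine hs (hEM ((hE s).2 ?_))
    obtain ⟨b, hb⟩ := hxs c hc
    rw [hb]
    refine Ideal.mul_mem_mul hx ((hB b).2 fun i hi => ?_)
    by_cases hx0 : x = 0
    · have : s * c = 0 := by rw [hb, hx0, zero_mul]
      rcases mul_eq_zero.1 this with h0 | h0
      · exact absurd (h0 ▸ M.zero_mem) hs
      · exact absurd h0 hc0
    obtain ⟨t, ht⟩ := hxs i hi
    refine ⟨t, mul_left_cancel₀ hx0 ?_⟩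
    linear_combination c * ht - i * hb

/-- The localization of a Prüfer domain at a prime ideal, as a valuation subring. -/
def IsPruferDomain.valuationSubringAt (h : IsPruferDomain D) (M : Ideal D) [hM : M.IsPrime] :
    ValuationSubring (FractionRing D) where
  carrier := {z | ∃ s ∉ M, ∃ r : D, algebraMap D (FractionRing D) s * z = algebraMap D _ r}
  mul_mem' := by
    rintro a b ⟨s, hs, r, hr⟩ ⟨s', hs', r', hr'⟩
    refine ⟨s * s', fun hm => (hM.mem_or_mem hm).elim hs hs', r * r', ?_⟩
    rw [map_mul, map_mul, ← hr, ← hr']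
    ring
  one_mem' := ⟨1, fun h1 => hM.ne_top ((Ideal.eq_top_iff_one M).2 h1), 1, by simp⟩
  add_mem' := by
    rintro a b ⟨s, hs, r, hr⟩ ⟨s', hs', r', hr'⟩
    refine ⟨s * s', fun hm => (hM.mem_or_mem hm).elim hs hs', s' * r + s * r', ?_⟩
    rw [map_mul, map_add, map_mul, map_mul, ← hr, ← hr']
    ring
  zero_mem' := ⟨1, fun h1 => hM.ne_top ((Ideal.eq_top_iff_one M).2 h1), 0, by simp⟩
  neg_mem' := by
    rintro a ⟨s, hs, r, hr⟩
    exact ⟨s, hs, -r, by rw [map_neg, ← hr]; ring⟩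
  mem_or_inv_mem' := by
    intro z
    obtain ⟨x, y, hy, rfl⟩ := IsFractionRing.div_surjective (A := D) z
    have hy' : algebraMap D (FractionRing D) y ≠ 0 := by simpa using hy
    by_cases hx : x = 0
    · exact Or.inl ⟨1, fun h1 => hM.ne_top ((Ideal.eq_top_iff_one M).2 h1), 0, by simp [hx]⟩
    have hx' : algebraMap D (FractionRing D) x ≠ 0 := by simpa using hx
    obtain ⟨s, hs, ⟨c, hc⟩ | ⟨c, hc⟩⟩ := h.exists_dvd_or_dvd M x y
    · refine Or.inl ⟨s, hs, c, ?_⟩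
      rw [← mul_div_assoc, ← map_mul, hc, map_mul, mul_div_cancel_left₀ _ hy']
    · refine Or.inr ⟨s, hs, c, ?_⟩
      rw [inv_div, ← mul_div_assoc, ← map_mul, hc, map_mul, mul_div_cancel_left₀ _ hx']

end Pruefer

/-! ### Contractions from localizations -/

section LocalContraction

variable {D : Type*} [CommRing D]

/-- The contraction `J D_M ∩ D`. -/
def localContraction (J M : Ideal D) [hM : M.IsPrime] : Ideal D where
  carrier := {d | ∃ s ∉ M, s * d ∈ J}
  zero_mem' := ⟨1, fun h1 => hM.ne_top ((Ideal.eq_top_iff_one M).2 h1), by simp⟩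
  add_mem' := by
    rintro a b ⟨s, hs, ha⟩ ⟨t, ht, hb⟩
    refine ⟨s * t, fun hm => (hM.mem_or_mem hm).elim hs ht, ?_⟩
    have := J.add_mem (J.mul_mem_left t ha) (J.mul_mem_left s hb)
    convert this using 1
    ring
  smul_mem' := by
    rintro c a ⟨s, hs, ha⟩
    refine ⟨s, hs, ?_⟩
    have := J.mul_mem_left c ha
    convert this using 1
    rw [smul_eq_mul]
    ring

variable (J M : Ideal D) [hM : M.IsPrime]

theorem le_localContraction : J ≤ localContraction J M := fun d hd =>
  ⟨1, fun h1 => hM.ne_top ((Ideal.eq_top_iff_one M).2 h1), by simpa using hd⟩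

variable {J M}

theorem localContraction_le (h : J ≤ M) : localContraction J M ≤ M := by
  rintro d ⟨s, hs, hd⟩
  exact (hM.mem_or_mem (h hd)).resolve_left hs

/-- J misses all products s t with s ∉ M and t ∉ L, since s t ∈ J would put t in the contraction and
so in L. A prime over J avoiding these products lies in both M and L. -/
theorem exists_isPrime_le_of_localContraction_le {L : Ideal D} [hL : L.IsPrime]
    (h : localContraction J M ≤ L) : ∃ P : Ideal D, P.IsPrime ∧ J ≤ P ∧ P ≤ M ∧ P ≤ L := by
  obtain ⟨P, hP, hle, hdisj⟩ := Ideal.exists_le_prime_disjoint J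
    (M.primeCompl ⊔ L.primeCompl) (by
      rw [Set.disjoint_left]
      intro x hx hx'
      obtain ⟨s, hs, t, ht, rfl⟩ := Submonoid.mem_sup.1 hx'
      exact ht (h ⟨s, hs, hx⟩))
  rw [Set.disjoint_left] at hdisj
  refine ⟨P, hP, hle, fun x hx => ?_, fun x hx => ?_⟩
  · by_contra hxM
    exact hdisj hx (Submonoid.mem_sup_left hxM)
  · by_contra hxM
    exact hdisj hx (Submonoid.mem_sup_right hxM)

theorem Ideal.FG.exists_mul_mem_of_le_localContraction {I : Ideal D} (hI : I.FG)
    (h : I ≤ localContraction J M) : ∃ s ∉ M, ∀ i ∈ I, s * i ∈ J := by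
  induction I, hI using Submodule.fg_induction with
  | singleton x =>
    obtain ⟨s, hs, hx⟩ := h (Submodule.mem_span_singleton_self x)
    refine ⟨s, hs, fun i hi => ?_⟩
    obtain ⟨a, rfl⟩ := Ideal.mem_span_singleton'.1 hi
    rw [mul_left_comm]
    exact J.mul_mem_left a hx
  | sup I I' hI hJ ihI ihJ =>
    obtain ⟨s, hs, hxs⟩ := ihI (le_sup_left.trans h)
    obtain ⟨t, ht, hyt⟩ := ihJ (le_sup_right.trans h)
    refine ⟨s * t, fun hm => (hM.mem_or_mem hm).elim hs ht, fun i hi => ?_⟩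
    obtain ⟨a, ha, b, hb, rfl⟩ := Submodule.mem_sup.1 hi
    have := J.add_mem (J.mul_mem_left t (hxs a ha)) (J.mul_mem_left s (hyt b hb))
    convert this using 1
    ring

theorem le_radical_localContraction {P : Ideal D}
    (h : ∀ q : Ideal D, q.IsPrime → q ≤ M → J ≤ q → P ≤ q) :
    P ≤ (localContraction J M).radical := by
  intro p hp
  by_contra hcon
  obtain ⟨q, hq, hle, hdisj⟩ := Ideal.exists_le_prime_disjoint J
    (M.primeCompl ⊔ Submonoid.powers p) (by
      rw [Set.disjoint_left]
      intro x hx hx'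
      obtain ⟨s, hs, t, ⟨n, rfl⟩, rfl⟩ := Submonoid.mem_sup.1 hx'
      exact hcon ⟨n, s, hs, hx⟩)
  rw [Set.disjoint_left] at hdisj
  refine hdisj (h q hq (fun x hx => ?_) hle hp)
    (Submonoid.mem_sup_right (Submonoid.mem_powers p))
  by_contra hxM
  exact hdisj hx (Submonoid.mem_sup_left hxM)

/-- Locally at M, P is inside the radical of J. Finite generation of I makes a single exponent and a
single denominator suffice. -/
theorem exists_mul_pow_mem_of_forall_le {P I : Ideal D}
    (h : ∀ q : Ideal D, q.IsPrime → q ≤ M → J ≤ q → P ≤ q) (hI : I.FG) (hIP : I ≤ P) :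
    ∃ s ∉ M, ∃ n : ℕ, ∀ e ∈ I ^ n, s * e ∈ J := by
  obtain ⟨n, hn⟩ := Ideal.exists_pow_le_of_le_radical_of_fg
    (hIP.trans (le_radical_localContraction h)) hI
  obtain ⟨s, hs, hse⟩ := (hI.pow (n := n)).exists_mul_mem_of_le_localContraction hn
  exact ⟨s, hs, n, hse⟩

end LocalContraction

/-! ### Incomparable elements in a treed domain -/

section Treed

variable {D : Type*} [CommRing D] [IsDomain D]

/-- Incomparability puts (y) : x and (x) : y inside M. Minimal primes of the two below M are
comparable, and the smaller one is contained in every prime below M that contains either colon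
ideal. -/
theorem IsTreedDomain.exists_prime_forall_fg (hD : IsTreedDomain D) {M : Ideal D}
    (hM : M.IsMaximal) {x y : D} (hx : ∀ s ∉ M, ¬ y ∣ s * x) (hy : ∀ s ∉ M, ¬ x ∣ s * y) :
    ∃ P : Ideal D, P.IsPrime ∧ P ≠ ⊥ ∧ ∀ I : Ideal D, I.FG → I ≤ P →
      (∃ s ∉ M, ∃ n : ℕ, ∀ e ∈ I ^ n, y ∣ s * x * e) ∧
      (∃ s ∉ M, ∃ n : ℕ, ∀ e ∈ I ^ n, x ∣ s * y * e) := by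
  -- The claim is symmetric in x and y, so the smaller minimal prime may be assumed to belong to (y)
  -- : x.
  wlog hPP : ∃ P P' : Ideal D, P ∈ ((Ideal.span {y}).colon {x}).minimalPrimes ∧
      P' ∈ ((Ideal.span {x}).colon {y}).minimalPrimes ∧ P ≤ P' ∧ P' ≤ M generalizing x y with H
  · have hmin : ∀ x y : D, (∀ s ∉ M, ¬ y ∣ s * x) →
        ∃ P ∈ ((Ideal.span {y}).colon {x}).minimalPrimes, P ≤ M := fun x y hx => by
      have hle : (Ideal.span {y}).colon {x} ≤ M := fun s hs => by
        by_contra hsM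
        exact hx s hsM (Ideal.mem_span_singleton.1 (Submodule.mem_colon_singleton.1 hs))
      have := hM.isPrime
      exact Ideal.exists_minimalPrimes_le hle
    obtain ⟨P, hP, hPM⟩ := hmin x y hx
    obtain ⟨P', hP', hPM'⟩ := hmin y x hy
    rcases hD M P P' hM hP.1.1 hP'.1.1 hPM hPM' with h | h
    · exact absurd ⟨P, P', hP, hP', h, hPM'⟩ hPP
    · obtain ⟨Q, hQ, hQ0, hQI⟩ := H hy hx ⟨P', P, hP', hP, h, hPM⟩
      exact ⟨Q, hQ, hQ0, fun I hI hIQ => (hQI I hI hIQ).symm⟩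
  · obtain ⟨P, P', hP, hP', hle, hPM'⟩ := hPP
    have hMp := hM.isPrime
    have hmem : ∀ {x y s : D}, s ∈ (Ideal.span {y}).colon {x} ↔ y ∣ s * x := fun {x y s} =>
      Submodule.mem_colon_singleton.trans Ideal.mem_span_singleton
    refine ⟨P, hP.1.1, ?_, fun I hI hIP => ⟨?_, ?_⟩⟩
    · rintro rfl
      have hy0 : y ∈ (Ideal.span {y}).colon {x} := hmem.2 (dvd_mul_right y x)
      have : y = 0 := by simpa using hP.1.2 hy0
      exact hy 1 (fun h1 => hMp.ne_top ((Ideal.eq_top_iff_one M).2 h1)) (by simp [this])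
    · obtain ⟨s, hs, n, h⟩ := exists_mul_pow_mem_of_forall_le (M := M)
        (J := (Ideal.span {y}).colon {x}) (P := P) (fun q hq hqM hJq =>
          (hD M P q hM hP.1.1 hq (hle.trans hPM') hqM).elim id fun hqP => hP.2 ⟨hq, hJq⟩ hqP) hI hIP
      refine ⟨s, hs, n, fun e he => ?_⟩
      have := hmem.1 (h e he)
      rwa [mul_right_comm]
    · obtain ⟨s, hs, n, h⟩ := exists_mul_pow_mem_of_forall_le (M := M)
        (J := (Ideal.span {x}).colon {y}) (P := P) (fun q hq hqM hJq =>
          -- If q ≤ P, then q ≤ P', so minimality of P' forces P ≤ P' ≤ q.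
          (hD M P q hM hP.1.1 hq (hle.trans hPM') hqM).elim id fun hqP =>
            hle.trans (hP'.2 ⟨hq, hJq⟩ (hqP.trans hle))) hI hIP
      refine ⟨s, hs, n, fun e he => ?_⟩
      have := hmem.1 (h e he)
      rwa [mul_right_comm]

end Treed

/-! ### From valuation ideals to h-locality and back -/

section HLocal

variable {D : Type*} [CommRing D] [IsDomain D]

/-- Every element of a maximal ideal above I is a nonunit of V. Two distinct such maximal ideals
would write 1 as a sum of two nonunits of the local ring V. -/
theorem IsPruferDomain.eq_of_isInvertibleIdeal_of_le (h : IsPruferDomain D) {I M N : Ideal D}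
    (hI : IsInvertibleIdeal I) (hV : IsValuationIdeal I) (hM : M.IsMaximal) (hN : N.IsMaximal)
    (hIM : I ≤ M) (hIN : I ≤ N) : M = N := by
  obtain ⟨V, hV⟩ := isValuationIdeal_iff.1 hV
  -- Take A with (I + tD) A = tD. If t⁻¹ ∈ V, then A I ⊆ t (IV ∩ D) = t I, so A ⊆ tD by
  -- cancellation. Then tD ⊆ M · tD, impossible for t ≠ 0.
  have key : ∀ M : Ideal D, M.IsMaximal → I ≤ M → ∀ t ∈ M,
      (algebraMap D (FractionRing D) t)⁻¹ ∈ V →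
      t = 0 := by
    intro M hM hIM t ht htV
    by_contra ht0
    have ht0' : algebraMap D (FractionRing D) t ≠ 0 := by simpa using ht0
    have htB : t ∈ I ⊔ Ideal.span {t} :=
      Ideal.mem_sup_right (Ideal.mem_span_singleton_self t)
    have hB : IsInvertibleIdeal (I ⊔ Ideal.span {t}) :=
      h _ (fun h0 => ht0 (by rw [h0] at htB; exact htB))
        (Submodule.FG.sup hI.fg (Submodule.fg_span_singleton t))
    obtain ⟨A, hA⟩ := hB.exists_mul_eq_span htB
    have hAI : A * I ≤ Ideal.span {t} * I := by
      rw [Ideal.mul_le]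
      intro a ha i hi
      have hai : i * a ∈ Ideal.span {t} := hA ▸ Ideal.mul_mem_mul (Ideal.mem_sup_left hi) ha
      obtain ⟨e, he⟩ := Ideal.mem_span_singleton.1 hai
      refine Ideal.mem_span_singleton_mul.2 ⟨e, ?_, by rw [← he, mul_comm]⟩
      refine hV.2 i hi e (algebraMap D _ a * (algebraMap D (FractionRing D) t)⁻¹)
        (V.mul_mem _ _ (hV.1 a) htV) ?_
      rw [← mul_assoc, ← map_mul, he, map_mul, mul_comm (algebraMap D _ t), mul_assoc,
        mul_inv_cancel₀ ht0', mul_one]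
    have hAt := hI.le_of_mul_le_mul hAI
    have hBM : I ⊔ Ideal.span {t} ≤ M :=
      sup_le hIM ((Ideal.span_singleton_le_iff_mem _).2 ht)
    have htM : Ideal.span {t} * ⊤ ≤ Ideal.span {t} * M := by
      rw [Ideal.mul_top, mul_comm]
      exact hA.ge.trans (Ideal.mul_mono hBM hAt)
    exact hM.ne_top (top_le_iff.1 ((Ideal.span_singleton_mul_right_mono ht0).1 htM))
  by_contra hne
  obtain ⟨m, hm, n, hn, hmn⟩ := Submodule.mem_sup.1
    ((Ideal.eq_top_iff_one _).1 (hM.coprime_of_ne hN hne))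
  have hnonunit : ∀ M : Ideal D, M.IsMaximal → I ≤ M → ∀ t ∈ M,
      algebraMap D (FractionRing D) t ∈ V.nonunits := by
    intro M hM hIM t ht
    rw [ValuationSubring.mem_nonunits_iff_exists_mem_maximalIdeal]
    refine ⟨hV.1 t, ?_⟩
    rw [IsLocalRing.mem_maximalIdeal, mem_nonunits_iff]
    rintro hu
    obtain ⟨v, hv⟩ := isUnit_iff_exists_inv.1 hu
    have hv' : algebraMap D (FractionRing D) t * v = 1 := congrArg Subtype.val hv
    have ht0 := key M hM hIM t ht (by rw [inv_eq_of_mul_eq_one_right hv']; exact v.2)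
    simp [ht0] at hv'
  obtain ⟨h1, h1'⟩ := ValuationSubring.mem_nonunits_iff_exists_mem_maximalIdeal.1
    (hnonunit M hM hIM m hm)
  obtain ⟨h2, h2'⟩ := ValuationSubring.mem_nonunits_iff_exists_mem_maximalIdeal.1
    (hnonunit N hN hIN n hn)
  have h3 := Ideal.add_mem _ h1' h2'
  apply (Ideal.ne_top_iff_one _).1 (IsLocalRing.maximalIdeal.isMaximal V).ne_top
  convert h3 using 1
  apply Subtype.ext
  change 1 = algebraMap D (FractionRing D) m + algebraMap D (FractionRing D) n
  rw [← map_add, hmn, map_one]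

/-- Products below I + (a) and I : a multiply to one below I, so this is an Oka property and only
primes need checking. Finite generation of the factors makes the product compact, which carries the
property from the union of a chain down to a member. -/
theorem Ideal.exists_multiset_prod_le {R : Type*} [CommRing R] {p : Ideal R → Prop} {c : R}
    (h : ∀ P : Ideal R, P.IsPrime → c ∈ P → ∃ I ≤ P, I.FG ∧ p I) (J : Ideal R) (hc : c ∈ J) :
    ∃ s : Multiset (Ideal R), (∀ I ∈ s, p I) ∧ s.prod ≤ J := by
  let Q : Ideal R → Prop := fun J => c ∈ J →
    ∃ s : Multiset (Ideal R), (∀ I ∈ s, I.FG ∧ p I) ∧ s.prod ≤ J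
  have hQ : Ideal.IsOka Q := by
    refine ⟨fun _ => ⟨0, by simp, le_top⟩, fun {I a} h1 h2 hcI => ?_⟩
    obtain ⟨s, hs, hsI⟩ := h1 (Ideal.mem_sup_left hcI)
    obtain ⟨t, ht, htI⟩ := h2 (Ideal.mem_colon_span_singleton.2 (I.mul_mem_right a hcI))
    refine ⟨s + t, fun B hB => (Multiset.mem_add.1 hB).elim (hs B) (ht B), ?_⟩
    rw [Multiset.prod_add]
    refine (Ideal.mul_mono hsI htI).trans ?_
    rw [Ideal.sup_mul, sup_le_iff]
    refine ⟨Ideal.mul_le_left, ?_⟩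
    rw [Ideal.mul_le]
    intro x hx y hy
    obtain ⟨b, rfl⟩ := Ideal.mem_span_singleton'.1 hx
    rw [mul_assoc, mul_comm a]
    exact I.mul_mem_left b (Ideal.mem_colon_span_singleton.1 hy)
  have hall : Q J := by
    refine hQ.forall_of_forall_prime' (fun C hC hchain K hK hsup => ?_) (fun P hP hcP => ?_) J
    · have hcC : ∀ B ∈ C, c ∈ B := fun B hB => by
        by_contra hcB
        exact hC hB fun hcB' => absurd hcB' hcB
      obtain ⟨s, hs, hsC⟩ := hsup (le_sSup hK (hcC K hK))
      have hfg : s.prod.FG := by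
        refine Multiset.prod_induction Ideal.FG s (fun a b ha hb => ha.mul hb)
          (by rw [Ideal.one_eq_top]; exact Ideal.fg_top R) fun B hB => (hs B hB).1
      obtain ⟨B, hB, hle⟩ := (CompleteLattice.isCompactElement_iff_le_of_directed_sSup_le _ _).1
        ((Submodule.fg_iff_compact _).1 hfg) C ⟨K, hK⟩ hchain.directedOn hsC
      exact ⟨B, hB, fun _ => ⟨s, hs, hle⟩⟩
    · obtain ⟨I, hI, hfg, hp⟩ := h P hP hcP
      exact ⟨{I}, by simpa using ⟨hfg, hp⟩, by simpa using hI⟩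
  obtain ⟨s, hs, hsJ⟩ := hall hc
  exact ⟨s, fun I hI => (hs I hI).2, hsJ⟩

/-- Every nonzero prime ideal contains an invertible valuation ideal. -/
def PrimesContainInvertibleValuationIdeals (D : Type*) [CommRing D] [IsDomain D] : Prop :=
  ∀ P : Ideal D, P.IsPrime → P ≠ ⊥ →
    ∃ I : Ideal D, I ≤ P ∧ IsInvertibleIdeal I ∧ IsValuationIdeal I

theorem IsPruferDomain.isHLocalDomain (h : IsPruferDomain D)
    (hD : PrimesContainInvertibleValuationIdeals D) : IsHLocalDomain D := by
  refine ⟨fun a ha _ => ?_, fun P hP hP0 => ?_⟩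
  · obtain ⟨s, hs, hsa⟩ := Ideal.exists_multiset_prod_le (c := a)
      (p := fun I => IsInvertibleIdeal I ∧ IsValuationIdeal I)
      (fun P hP haP => by
        obtain ⟨I, hIP, hI, hIV⟩ := hD P hP (fun h0 => ha (by rw [h0] at haP; exact haP))
        exact ⟨I, hIP, hI.fg, hI, hIV⟩) (Ideal.span {a}) (Ideal.mem_span_singleton_self a)
    have hfin : (⋃ I ∈ {I | I ∈ s}, {M : Ideal D | M.IsMaximal ∧ I ≤ M}).Finite := by
      refine Set.Finite.biUnion (Multiset.finite_toSet s) fun I hI => Set.Subsingleton.finite ?_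
      rintro M ⟨hM, hIM⟩ N ⟨hN, hIN⟩
      exact h.eq_of_isInvertibleIdeal_of_le (hs I hI).1 (hs I hI).2 hM hN hIM hIN
    refine hfin.subset ?_
    rintro M ⟨hM, haM⟩
    obtain ⟨I, hI, hIM⟩ := (hM.isPrime.multiset_prod_le).1
      (hsa.trans ((Ideal.span_singleton_le_iff_mem _).2 haM))
    exact Set.mem_biUnion hI ⟨hM, hIM⟩
  · obtain ⟨M, hM, hPM⟩ := Ideal.exists_le_maximal P hP.ne_top
    obtain ⟨I, hIP, hI, hIV⟩ := hD P hP hP0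
    exact ⟨M, ⟨hM, hPM⟩, fun N ⟨hN, hPN⟩ =>
      h.eq_of_isInvertibleIdeal_of_le hI hIV hN hM (hIP.trans hPN) (hIP.trans hPM)⟩

theorem IsTreedDomain.isPruferDomain (hT : IsTreedDomain D)
    (hD : PrimesContainInvertibleValuationIdeals D) : IsPruferDomain D := by
  refine isPruferDomain_of_forall_isMaximal fun M hM x y => ?_
  by_contra! hcon
  obtain ⟨P, hP, hP0, hPI⟩ := hT.exists_prime_forall_fg hM (fun s hs => (hcon s hs).1)
    (fun s hs => (hcon s hs).2)
  obtain ⟨I, hIP, hI, hIV⟩ := hD P hP hP0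
  obtain ⟨V, hV⟩ := isValuationIdeal_iff.1 hIV
  obtain ⟨⟨s, hs, n, hn⟩, t, ht, m, hm⟩ := hPI I hI.fg hIP
  have hx0 : x ≠ 0 := by
    rintro rfl
    exact (hcon s hs).1 (by simp)
  have hy0 : y ≠ 0 := by
    rintro rfl
    exact (hcon s hs).2 (by simp)
  have hx0' : algebraMap D (FractionRing D) x ≠ 0 := by simpa using hx0
  have hy0' : algebraMap D (FractionRing D) y ≠ 0 := by simpa using hy0
  rcases V.mem_or_inv_mem (algebraMap D (FractionRing D) x / algebraMap D _ y) with hz | hz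
  · exact (hcon s hs).1 (hV.dvd_mul_of_forall_mem_pow hI hz (by field_simp) hy0 hn)
  · rw [inv_div] at hz
    exact (hcon t ht).2 (hV.dvd_mul_of_forall_mem_pow hI hz (by field_simp) hx0 hm)

theorem IsProductOfValuationIdeals.primesContainInvertibleValuationIdeals
    (h : ∀ a : D, a ≠ 0 → IsProductOfValuationIdeals (Ideal.span {a})) :
    PrimesContainInvertibleValuationIdeals D := by
  intro P hP hP0
  obtain ⟨a, haP, ha⟩ := Submodule.exists_mem_ne_zero_of_ne_bot hP0
  obtain ⟨n, I, -, hI, hprod⟩ := h a ha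
  have hle : ∏ i, I i ≤ P := by
    rw [← hprod]
    exact (Ideal.span_singleton_le_iff_mem _).2 haP
  obtain ⟨i, -, hi⟩ := hP.prod_le.1 hle
  exact ⟨I i, hi, (isInvertibleIdeal_span_singleton ha).of_dvd
    (hprod ▸ Finset.dvd_prod_of_mem I (Finset.mem_univ i)), hI i⟩

theorem IsPruferDomain.isValuationIdeal_localContraction (h : IsPruferDomain D) (J M : Ideal D)
    [hM : M.IsPrime] : IsValuationIdeal (localContraction J M) := by
  refine isValuationIdeal_iff.2 ⟨h.valuationSubringAt M, fun d =>
    ⟨1, fun h1 => hM.ne_top ((Ideal.eq_top_iff_one M).2 h1), d, by simp⟩, ?_⟩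
  rintro i ⟨t, ht, hi⟩ d v ⟨s, hs, r, hr⟩ hd
  refine ⟨t * s, fun hm => (hM.mem_or_mem hm).elim ht hs, ?_⟩
  have : s * d = i * r := by
    apply IsFractionRing.injective D (FractionRing D)
    rw [map_mul, map_mul, hd, ← hr]
    ring
  rw [mul_assoc, this, ← mul_assoc]
  exact J.mul_mem_right r hi

/-- The factors are J D_M ∩ D for the maximal M ⊇ J. Two of them in a common maximal L would give
nonzero primes below M and L, and below M' and L, so M = L = M'. The last clause later keeps the
factors of a nonunit nonunits. -/
theorem IsHLocalDomain.exists_comaximal_valuationIdeals (hl : IsHLocalDomain D)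
    (hP : IsPruferDomain D) {J : Ideal D} (hJ : J ≠ ⊥) :
    ∃ (n : ℕ) (I : Fin n → Ideal D), 0 < n ∧ (∀ i, IsValuationIdeal (I i)) ∧
      (∀ i j, i ≠ j → I i ⊔ I j = ⊤) ∧ J = ⨅ i, I i ∧ (J ≠ ⊤ → ∀ i, I i ≠ ⊤) := by
  -- No maximal ideal contains J = D, while at least one factor is demanded; D itself serves.
  by_cases htop : J = ⊤
  · exact ⟨1, fun _ => ⊤, one_pos, fun _ => isValuationIdeal_top, by simp, by simp [htop],
      fun h => absurd htop h⟩
  let S : Set (Ideal D) := {M | M.IsMaximal ∧ J ≤ M}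
  have hS : S.Finite := by
    obtain ⟨a, haJ, ha⟩ := Submodule.exists_mem_ne_zero_of_ne_bot hJ
    refine (hl.1 a ha fun hu => htop (Ideal.eq_top_of_isUnit_mem _ haJ hu)).subset ?_
    rintro M ⟨hM, hJM⟩
    exact ⟨hM, hJM haJ⟩
  have := hS.to_subtype
  let e := Finite.equivFin S
  have hprime : ∀ M : S, M.1.IsPrime := fun M => M.2.1.isPrime
  let I : S → Ideal D := fun M => localContraction J M.1
  have hIL : ∀ (M : S) (L : Ideal D), L.IsMaximal → I M ≤ L → M.1 = L := by
    intro M L hL hle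
    have := hL.isPrime
    obtain ⟨P, hPp, hJP, hPM, hPL⟩ := exists_isPrime_le_of_localContraction_le hle
    exact (hl.2 P hPp fun h0 => hJ (le_bot_iff.1 (h0 ▸ hJP))).unique ⟨M.2.1, hPM⟩ ⟨hL, hPL⟩
  refine ⟨Nat.card S, fun i => I (e.symm i), ?_, fun i => hP.isValuationIdeal_localContraction _ _,
    fun i j hij => ?_, ?_, fun _ i => ?_⟩
  · obtain ⟨M, hM, hJM⟩ := Ideal.exists_le_maximal J htop
    have : Nonempty S := ⟨⟨M, hM, hJM⟩⟩
    exact Nat.card_pos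
  · by_contra hne
    obtain ⟨L, hL, hle⟩ := Ideal.exists_le_maximal _ hne
    have h1 := hIL _ L hL (le_sup_left.trans hle)
    have h2 := hIL _ L hL (le_sup_right.trans hle)
    exact hij (e.symm.injective (Subtype.ext (h1.trans h2.symm)))
  · refine le_antisymm (le_iInf fun i => le_localContraction _ _) fun d hd => ?_
    rw [Ideal.mem_iInf] at hd
    have hcol : J.colon {d} = ⊤ := by
      by_contra hne
      obtain ⟨L, hL, hle⟩ := Ideal.exists_le_maximal _ hne
      have hJL : J ≤ L := le_trans (fun x hx =>
        Submodule.mem_colon_singleton.2 (J.mul_mem_right d hx)) hle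
      obtain ⟨s, hs, hsd⟩ : d ∈ I ⟨L, hL, hJL⟩ := by
        have h1 := hd (e ⟨L, hL, hJL⟩)
        simpa only [e.symm_apply_apply] using h1
      exact hs (hle (Submodule.mem_colon_singleton.2 hsd))
    have h1 : (1 : D) ∈ J.colon {d} := hcol ▸ Submodule.mem_top
    simpa using Submodule.mem_colon_singleton.1 h1
  · exact ne_top_of_le_ne_top (e.symm i).2.1.ne_top (localContraction_le (e.symm i).2.2)

theorem Ideal.iInf_eq_prod_of_pairwise_sup_eq_top {R : Type*} [CommRing R] {n : ℕ}
    {I : Fin n → Ideal R} (h : ∀ i j, i ≠ j → I i ⊔ I j = ⊤) : ⨅ i, I i = ∏ i, I i := by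
  have := Ideal.prod_eq_iInf_of_pairwise_isCoprime (J := I) (s := Finset.univ)
    fun i _ j _ hij => Ideal.isCoprime_iff_sup_eq.2 (h i j hij)
  rw [this]
  simp

end HLocal

/-! ### Content ideals -/

namespace Polynomial

section Content

variable {R : Type*} [CommRing R]

theorem contentIdeal_le_iff {p : R[X]} {I : Ideal R} :
    p.contentIdeal ≤ I ↔ ∀ n, p.coeff n ∈ I := by
  refine ⟨fun h n => h (coeff_mem_contentIdeal p n), fun h => ?_⟩
  rw [contentIdeal_def, Ideal.span_le]
  intro c hc
  obtain ⟨n, -, rfl⟩ := mem_coeffs_iff.1 hc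
  exact h n

theorem contentIdeal_eq_span_range (p : R[X]) :
    p.contentIdeal = Ideal.span (Set.range p.coeff) := by
  refine le_antisymm (contentIdeal_le_iff.2 fun n => Ideal.subset_span ⟨n, rfl⟩) ?_
  rw [Ideal.span_le]
  rintro _ ⟨n, rfl⟩
  exact coeff_mem_contentIdeal p n

theorem contentIdeal_add_X_pow_mul (p q : R[X]) {N : ℕ} (hN : p.natDegree < N) :
    (p + X ^ N * q).contentIdeal = p.contentIdeal ⊔ q.contentIdeal := by
  refine le_antisymm (contentIdeal_le_iff.2 fun n => ?_) (sup_le ?_ ?_)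
  · rw [coeff_add, coeff_X_pow_mul']
    refine Submodule.add_mem_sup (coeff_mem_contentIdeal p n) ?_
    split_ifs
    · exact coeff_mem_contentIdeal q _
    · exact Ideal.zero_mem _
  · rw [contentIdeal_le_iff]
    intro n
    by_cases hn : N ≤ n
    · rw [coeff_eq_zero_of_natDegree_lt (hN.trans_le hn)]
      exact Ideal.zero_mem _
    · have := coeff_mem_contentIdeal (p + X ^ N * q) n
      rwa [coeff_add, coeff_X_pow_mul', if_neg hn, add_zero] at this
  · rw [contentIdeal_le_iff]
    intro n
    have := coeff_mem_contentIdeal (p + X ^ N * q) (n + N)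
    rwa [coeff_add, coeff_X_pow_mul, coeff_eq_zero_of_natDegree_lt (by lia), zero_add] at this

theorem _root_.Ideal.FG.exists_contentIdeal_eq {I : Ideal R} (hI : I.FG) :
    ∃ p : R[X], p.contentIdeal = I := by
  induction I, hI using Submodule.fg_induction with
  | singleton x => exact ⟨C x, contentIdeal_C x⟩
  | sup I J _ _ hI hJ =>
    obtain ⟨p, rfl⟩ := hI
    obtain ⟨q, rfl⟩ := hJ
    exact ⟨p + X ^ (p.natDegree + 1) * q, contentIdeal_add_X_pow_mul p q (Nat.lt_succ_self _)⟩

/-- Since deg p < N, an exponent i + N j with i < N is reached only from the pair (i, j), as in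
base-N digits. -/
theorem coeff_mul_expand (p q : R[X]) {N : ℕ} (hN : p.natDegree < N) {i : ℕ} (hi : i < N)
    (j : ℕ) : (p * expand R N q).coeff (i + N * j) = p.coeff i * q.coeff j := by
  have hN0 : 0 < N := by lia
  rw [coeff_mul, Finset.sum_eq_single (i, N * j)]
  · rw [coeff_expand_mul' hN0]
  · rintro ⟨a, b⟩ hab hne
    rw [Finset.HasAntidiagonal.mem_antidiagonal] at hab
    rw [coeff_expand hN0]
    split_ifs with hb
    · obtain ⟨b, rfl⟩ := hb
      dsimp only at hab ⊢
      rw [coeff_eq_zero_of_natDegree_lt, zero_mul]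
      by_contra! hle
      have ha : a < N := by lia
      have h1 : a = i := by
        have := congrArg (· % N) hab
        simpa [Nat.mod_eq_of_lt ha, Nat.mod_eq_of_lt hi] using this
      subst h1
      exact hne (by rw [Nat.add_left_cancel hab])
    · rw [mul_zero]
  · intro h
    exact absurd (by rw [Finset.HasAntidiagonal.mem_antidiagonal]) h

/-- Spreading out q turns every product of coefficients into a coefficient, so content is
multiplicative here over any commutative ring. -/
theorem contentIdeal_mul_expand (p q : R[X]) {N : ℕ} (hN : p.natDegree < N) :
    (p * expand R N q).contentIdeal = p.contentIdeal * q.contentIdeal := by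
  refine le_antisymm ((contentIdeal_mul_le_mul_contentIdeal _ _).trans
    (Ideal.mul_mono_right (contentIdeal_le_iff.2 fun n => ?_))) ?_
  · rw [coeff_expand (by lia)]
    split_ifs
    · exact coeff_mem_contentIdeal q _
    · exact Ideal.zero_mem _
  · rw [contentIdeal_eq_span_range p, contentIdeal_eq_span_range q, Ideal.span_mul_span',
      Ideal.span_le]
    rintro _ ⟨_, ⟨i, rfl⟩, _, ⟨j, rfl⟩, rfl⟩
    dsimp only
    by_cases hi : i < N
    · rw [← coeff_mul_expand p q hN hi]
      exact coeff_mem_contentIdeal _ _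
    · rw [coeff_eq_zero_of_natDegree_lt (by lia), zero_mul]
      exact Ideal.zero_mem _

/-- McCoy's theorem modulo d: a zero divisor in a polynomial ring is killed by a nonzero constant,
which unit content excludes. -/
theorem C_dvd_of_dvd_mul_of_contentIdeal_eq_top {g h : R[X]} (hg : g.contentIdeal = ⊤) {d : R}
    (hd : C d ∣ h * g) : C d ∣ h := by
  have hker : ∀ p : R[X], C d ∣ p ↔ p.map (Ideal.Quotient.mk (Ideal.span {d})) = 0 := by
    intro p
    rw [C_dvd_iff_dvd_coeff, Polynomial.ext_iff]
    refine forall_congr' fun n => ?_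
    rw [coeff_map, coeff_zero, Ideal.Quotient.eq_zero_iff_mem, Ideal.mem_span_singleton]
  rw [hker] at hd ⊢
  rw [Polynomial.map_mul] at hd
  refine (mem_nonZeroDivisors_iff_right.1 (Polynomial.mem_nonZeroDivisors_iff.2 fun a ha => ?_))
    _ hd
  have htop : (g.map (Ideal.Quotient.mk (Ideal.span {d}))).contentIdeal ≤
      (⊥ : Ideal (R ⧸ Ideal.span {d})).colon {a} := by
    rw [contentIdeal_le_iff]
    intro n
    rw [Submodule.mem_colon_singleton, Submodule.mem_bot, smul_eq_mul, mul_comm]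
    simpa using congrArg (fun p => coeff p n) ha
  rw [contentIdeal_map_eq_map_contentIdeal, hg, Ideal.map_top] at htop
  simpa using Submodule.mem_colon_singleton.1 (htop (Submodule.mem_top (x := 1)))

end Content

end Polynomial

/-! ### The Nagata ring, in particular over a Prüfer domain -/

section Nagata

variable {D : Type*} [CommRing D]

theorem mem_unitContentSubmonoid {g : D[X]} :
    g ∈ unitContentSubmonoid D ↔ g.contentIdeal = ⊤ := Iff.rfl

theorem NagataRing.exists_associated_algebraMap (r : NagataRing D) :
    ∃ f : D[X], Associated (algebraMap D[X] (NagataRing D) f) r := by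
  obtain ⟨⟨f, g⟩, h⟩ := IsLocalization.surj (unitContentSubmonoid D) r
  obtain ⟨u, hu⟩ := IsLocalization.map_units (NagataRing D) g
  refine ⟨f, Associated.symm ⟨u, ?_⟩⟩
  rw [hu, h]

/-- The extension of an ideal of `D` to the Nagata ring. -/
def nagataExtension (M : Ideal D) : Ideal (NagataRing D) :=
  (M.map (C : D →+* D[X])).map (algebraMap D[X] (NagataRing D))

theorem disjoint_unitContentSubmonoid_map_C {M : Ideal D} (hM : M ≠ ⊤) :
    Disjoint (unitContentSubmonoid D : Set D[X]) (M.map (C : D →+* D[X])) := by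
  rw [Set.disjoint_left]
  intro g hg hgM
  exact hM (top_le_iff.1 (mem_unitContentSubmonoid.1 hg ▸
    contentIdeal_le_iff.2 (Ideal.mem_map_C_iff.1 hgM)))

theorem nagataExtension_ne_top {M : Ideal D} (hM : M ≠ ⊤) : nagataExtension M ≠ ⊤ :=
  (IsLocalization.map_algebraMap_ne_top_iff_disjoint (unitContentSubmonoid D) _ _).2
    (disjoint_unitContentSubmonoid_map_C hM)

theorem algebraMap_C_mem_nagataExtension {M : Ideal D} {d : D} (hd : d ∈ M) :
    algebraMap D[X] (NagataRing D) (C d) ∈ nagataExtension M :=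
  Ideal.mem_map_of_mem _ (Ideal.mem_map_of_mem _ hd)

theorem nagataExtension_isPrime {P : Ideal D} (hP : P.IsPrime) : (nagataExtension P).IsPrime :=
  IsLocalization.isPrime_of_isPrime_disjoint (unitContentSubmonoid D) _ _
    Ideal.isPrime_map_C_of_isPrime (disjoint_unitContentSubmonoid_map_C hP.ne_top)

theorem algebraMap_mem_nagataExtension_iff {P : Ideal D} (hP : P.IsPrime) {f : D[X]} :
    algebraMap D[X] (NagataRing D) f ∈ nagataExtension P ↔ f.contentIdeal ≤ P := by
  rw [contentIdeal_le_iff, ← Ideal.mem_map_C_iff]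
  refine ⟨fun hf => ?_, fun hf => Ideal.mem_map_of_mem _ hf⟩
  rw [← IsLocalization.under_map_of_isPrime_disjoint (unitContentSubmonoid D) (NagataRing D)
    Ideal.isPrime_map_C_of_isPrime (disjoint_unitContentSubmonoid_map_C hP.ne_top)]
  exact hf

variable [IsDomain D]

theorem NagataRing.algebraMap_injective :
    Function.Injective (algebraMap D[X] (NagataRing D)) :=
  IsLocalization.injective _ (unitContentSubmonoid_le_nonZeroDivisors D)

theorem NagataRing.algebraMap_dvd_algebraMap_iff {p q : D[X]} :
    algebraMap D[X] (NagataRing D) p ∣ algebraMap D[X] (NagataRing D) q ↔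
      ∃ g : D[X], g.contentIdeal = ⊤ ∧ p ∣ q * g := by
  constructor
  · rintro ⟨r, hr⟩
    obtain ⟨⟨f, g⟩, h⟩ := IsLocalization.surj (unitContentSubmonoid D) r
    refine ⟨g, g.2, f, algebraMap_injective ?_⟩
    rw [map_mul, map_mul, hr, mul_assoc, h]
  · rintro ⟨g, hg, h⟩
    have hu : IsUnit (algebraMap D[X] (NagataRing D) g) :=
      IsLocalization.map_units (M := unitContentSubmonoid D) (NagataRing D) ⟨g, hg⟩
    rw [← hu.dvd_mul_right, ← map_mul]
    exact map_dvd _ h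

/-- Clearing denominators gives f ∣ d g with c(g) = D, and then d c(g) ⊆ c(f). -/
theorem NagataRing.mem_contentIdeal_of_algebraMap_dvd {f : D[X]} {d : D}
    (h : algebraMap D[X] (NagataRing D) f ∣ algebraMap D[X] (NagataRing D) (C d)) :
    d ∈ f.contentIdeal := by
  obtain ⟨g, hg, hdvd⟩ := algebraMap_dvd_algebraMap_iff.1 h
  have hle : g.contentIdeal ≤ f.contentIdeal.colon {d} := by
    rw [contentIdeal_le_iff]
    intro n
    rw [Submodule.mem_colon_singleton, smul_eq_mul, mul_comm, ← coeff_C_mul]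
    exact contentIdeal_le_contentIdeal_of_dvd hdvd (coeff_mem_contentIdeal _ n)
  rw [hg] at hle
  simpa using Submodule.mem_colon_singleton.1 (hle (Submodule.mem_top : (1 : D) ∈ _))

/-- Choose B with c(f) B = (c) and a polynomial with content B. Its spread-out multiple of f has
content exactly (c), so dividing by c leaves unit content. -/
theorem IsPruferDomain.exists_C_mul_eq_mul (h : IsPruferDomain D) {f : D[X]} {c : D}
    (hc : c ∈ f.contentIdeal) (hc0 : c ≠ 0) :
    ∃ g k : D[X], g.contentIdeal = ⊤ ∧ C c * g = f * k := by
  have hf : f.contentIdeal ≠ ⊥ := fun h0 => hc0 (by rw [h0] at hc; exact hc)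
  obtain ⟨B, hB⟩ := (h _ hf (contentIdeal_FG f)).exists_mul_eq_span hc
  have hBinv : IsInvertibleIdeal B :=
    (isInvertibleIdeal_span_singleton hc0).of_dvd ⟨_, by rw [mul_comm, hB]⟩
  obtain ⟨k, hk⟩ := hBinv.fg.exists_contentIdeal_eq
  have hcont := contentIdeal_mul_expand f k (Nat.lt_succ_self f.natDegree)
  rw [hk, hB] at hcont
  obtain ⟨g, hg⟩ : C c ∣ f * expand D f.natDegree.succ k := by
    rw [C_dvd_iff_dvd_coeff]
    intro n
    rw [← Ideal.mem_span_singleton, ← hcont]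
    exact coeff_mem_contentIdeal _ n
  refine ⟨g, _, top_le_iff.1 ((Ideal.span_singleton_mul_right_mono hc0).1 ?_), hg.symm⟩
  calc Ideal.span {c} * ⊤ = (C c * g).contentIdeal := by rw [Ideal.mul_top, ← hg, hcont]
    _ ≤ (C c).contentIdeal * g.contentIdeal := contentIdeal_mul_le_mul_contentIdeal _ _
    _ = _ := by rw [contentIdeal_C]

theorem IsPruferDomain.algebraMap_dvd_algebraMap_C (h : IsPruferDomain D) {f : D[X]} {c : D}
    (hc : c ∈ f.contentIdeal) :
    algebraMap D[X] (NagataRing D) f ∣ algebraMap D[X] (NagataRing D) (C c) := by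
  by_cases hc0 : c = 0
  · simp [hc0]
  obtain ⟨g, k, hg, hk⟩ := h.exists_C_mul_eq_mul hc hc0
  exact NagataRing.algebraMap_dvd_algebraMap_iff.2 ⟨g, hg, k, hk⟩

theorem IsPruferDomain.algebraMap_mem_iff (h : IsPruferDomain D) {B : Ideal (NagataRing D)}
    {f : D[X]} : algebraMap D[X] (NagataRing D) f ∈ B ↔
      ∀ n, algebraMap D[X] (NagataRing D) (C (f.coeff n)) ∈ B := by
  constructor
  · intro hf n
    exact B.mem_of_dvd (h.algebraMap_dvd_algebraMap_C (coeff_mem_contentIdeal f n)) hf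
  · intro hf
    rw [f.as_sum_range_C_mul_X_pow, map_sum]
    refine B.sum_mem fun n _ => ?_
    rw [map_mul]
    exact B.mul_mem_right _ (hf n)

theorem IsPruferDomain.nagataRing_le_of_forall_C (h : IsPruferDomain D)
    {B B' : Ideal (NagataRing D)}
    (hB : ∀ d : D, algebraMap D[X] (NagataRing D) (C d) ∈ B →
      algebraMap D[X] (NagataRing D) (C d) ∈ B') : B ≤ B' := by
  intro r hr
  obtain ⟨f, hf⟩ := NagataRing.exists_associated_algebraMap r
  refine B'.mem_of_dvd hf.dvd (h.algebraMap_mem_iff.2 fun n => hB _ ?_)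
  exact h.algebraMap_mem_iff.1 (B.mem_of_dvd hf.symm.dvd hr) n

/-- Divisibility between polynomials is governed by content, so p + X^N q with N > deg p, whose
content is c(p) + c(q), generates the ideal (p, q). -/
theorem IsPruferDomain.isBezout_nagataRing (h : IsPruferDomain D) : IsBezout (NagataRing D) := by
  rw [IsBezout.iff_span_pair_isPrincipal]
  intro x y
  obtain ⟨p, hp⟩ := NagataRing.exists_associated_algebraMap x
  obtain ⟨q, hq⟩ := NagataRing.exists_associated_algebraMap y
  let f := p + X ^ (p.natDegree + 1) * q
  have hcont : f.contentIdeal = _ := contentIdeal_add_X_pow_mul p q (Nat.lt_succ_self _)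
  have hdvd : ∀ q : D[X], q.contentIdeal ≤ f.contentIdeal →
      algebraMap D[X] (NagataRing D) f ∣ algebraMap D[X] (NagataRing D) q := by
    intro q hq
    rw [← Ideal.mem_span_singleton, h.algebraMap_mem_iff]
    exact fun n => Ideal.mem_span_singleton.2
      (h.algebraMap_dvd_algebraMap_C (hq (coeff_mem_contentIdeal q n)))
  refine ⟨algebraMap D[X] (NagataRing D) f, le_antisymm ?_ ?_⟩
  · rw [Ideal.span_le, Set.pair_subset_iff]
    exact ⟨Ideal.mem_span_singleton.2 ((hdvd p (hcont ▸ le_sup_left)).trans hp.dvd),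
      Ideal.mem_span_singleton.2 ((hdvd q (hcont ▸ le_sup_right)).trans hq.dvd)⟩
  · rw [Submodule.span_singleton_le_iff_mem, map_add, map_mul]
    refine Ideal.add_mem _ (Ideal.mem_of_dvd _ hp.symm.dvd (Ideal.subset_span (by simp)))
      (Ideal.mul_mem_left _ _ (Ideal.mem_of_dvd _ hq.symm.dvd (Ideal.subset_span (by simp))))

theorem IsBezout.isPruferDomain {R : Type*} [CommRing R] [IsDomain R] [IsBezout R] :
    IsPruferDomain R := by
  intro I hI hfg
  obtain ⟨c, rfl⟩ := (IsBezout.isPrincipal_of_FG I hfg).1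
  exact isInvertibleIdeal_span_singleton fun h0 => hI (by simp [h0])

/-- Ideals of D(X) are determined by their constants, so each maximal ideal is the extension of a
maximal ideal of D and both finiteness and uniqueness are read off in D. -/
theorem IsHLocalDomain.nagataRing (hl : IsHLocalDomain D) (h : IsPruferDomain D) :
    IsHLocalDomain (NagataRing D) := by
  let ι : D →+* NagataRing D := (algebraMap D[X] (NagataRing D)).comp C
  have hne : ∀ B : Ideal (NagataRing D), B ≠ ⊥ → B.comap ι ≠ ⊥ := fun B hB h0 =>
    hB (le_bot_iff.1 (h.nagataRing_le_of_forall_C fun d hd => by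
      have : d ∈ B.comap ι := hd
      rw [h0, Ideal.mem_bot] at this
      simp [this]))
  have hmax : ∀ N : Ideal (NagataRing D), N.IsMaximal → ∀ M : Ideal D, M.IsMaximal →
      N.comap ι ≤ M → N = nagataExtension M := fun N hN M hM hle =>
    hN.eq_of_le (nagataExtension_ne_top hM.ne_top) (h.nagataRing_le_of_forall_C fun d hd =>
      algebraMap_C_mem_nagataExtension (hle hd))
  have hex : ∀ N : Ideal (NagataRing D), N.IsMaximal → ∃ M : Ideal D, M.IsMaximal ∧
      N.comap ι ≤ M := fun N hN => Ideal.exists_le_maximal _ (Ideal.comap_ne_top ι hN.ne_top)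
  refine ⟨fun a ha hau => ?_, fun P hP hP0 => ?_⟩
  · obtain ⟨d, hd, hd0⟩ := Submodule.exists_mem_ne_zero_of_ne_bot
      (hne (Ideal.span {a}) (by simpa using ha))
    have hda : a ∣ ι d := Ideal.mem_span_singleton.1 hd
    have hdu : ¬ IsUnit d := fun hu => hau (isUnit_of_dvd_unit hda (hu.map ι))
    refine ((hl.1 d hd0 hdu).image nagataExtension).subset ?_
    rintro N ⟨hN, haN⟩
    obtain ⟨M, hM, hle⟩ := hex N hN
    exact ⟨M, ⟨hM, hle (N.mem_of_dvd hda haN)⟩, (hmax N hN M hM hle).symm⟩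
  · obtain ⟨N, hN, hPN⟩ := Ideal.exists_le_maximal P hP.ne_top
    refine ⟨N, ⟨hN, hPN⟩, fun N' ⟨hN', hPN'⟩ => ?_⟩
    obtain ⟨M, hM, hle⟩ := hex N hN
    obtain ⟨M', hM', hle'⟩ := hex N' hN'
    have hMM : M = M' := (hl.2 _ (hP.comap ι) (hne P hP0)).unique
      ⟨hM, (Ideal.comap_mono hPN).trans hle⟩ ⟨hM', (Ideal.comap_mono hPN').trans hle'⟩
    rw [hmax N hN M hM hle, hmax N' hN' M' hM' hle', hMM]

end Nagata

/-! ### Uppers to zero and t-ideals -/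

section UMT

theorem Polynomial.exists_minimal_natDegree {R : Type*} [CommRing R] {N : Ideal R[X]}
    (hN : N ≠ ⊥) :
    ∃ n ∈ N, n ≠ 0 ∧ ∀ q ∈ N, q ≠ 0 → n.natDegree ≤ q.natDegree := by
  obtain ⟨p, hp, hp0⟩ := Submodule.exists_mem_ne_zero_of_ne_bot hN
  obtain ⟨n, ⟨hn, hn0⟩, hmin⟩ := WellFounded.has_min
    (InvImage.wf (fun p : R[X] => p.natDegree) Nat.lt_wfRel.wf) {p | p ∈ N ∧ p ≠ 0} ⟨p, hp, hp0⟩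
  exact ⟨n, hn, hn0, fun q hq hq0 => not_lt.1 (hmin q ⟨hq, hq0⟩)⟩

variable {D : Type*} [CommRing D] [IsDomain D]

/-- Pseudo-division: cancelling leading terms stays inside N and lowers the degree. -/
theorem Polynomial.exists_C_mul_dvd_of_minimal_natDegree {N : Ideal D[X]} {n : D[X]} (hn : n ∈ N)
    (hn0 : n ≠ 0) (hmin : ∀ q ∈ N, q ≠ 0 → n.natDegree ≤ q.natDegree) {q : D[X]} (hq : q ∈ N) :
    ∃ d : D, d ≠ 0 ∧ n ∣ C d * q := by
  induction hdeg : q.natDegree using Nat.strong_induction_on generalizing q with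
  | _ m ih =>
    by_cases hq0 : q = 0
    · exact ⟨1, one_ne_zero, by simp [hq0]⟩
    have hle := hmin q hq hq0
    by_cases hm : m = 0
    · have h0 : n.natDegree = 0 := by lia
      rw [natDegree_eq_zero] at h0
      obtain ⟨a, rfl⟩ := h0
      exact ⟨a, by simpa using hn0, dvd_mul_right _ _⟩
    · have hlt := natDegree_cancelLeads_lt_of_natDegree_le_natDegree hle (by lia)
      have hdef : n.cancelLeads q = C n.leadingCoeff * q -
          C q.leadingCoeff * X ^ (q.natDegree - n.natDegree) * n := by
        simp [cancelLeads, Nat.sub_eq_zero_of_le hle]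
      have hmem : n.cancelLeads q ∈ N := by
        rw [hdef]
        exact N.sub_mem (N.mul_mem_left _ hq) (N.mul_mem_left _ hn)
      obtain ⟨d, hd, e, he⟩ := ih _ (hdeg ▸ hlt) hmem rfl
      refine ⟨d * n.leadingCoeff, mul_ne_zero hd (leadingCoeff_ne_zero.2 hn0),
        e + C d * C q.leadingCoeff * X ^ (q.natDegree - n.natDegree), ?_⟩
      rw [hdef] at he
      rw [C_mul]
      linear_combination he

theorem Polynomial.exists_C_mul_dvd_of_fg {f : D[X]} {J : Ideal D[X]} (hJ : J.FG)
    (h : ∀ q ∈ J, ∃ d : D, d ≠ 0 ∧ f ∣ C d * q) : ∃ d : D, d ≠ 0 ∧ ∀ q ∈ J, f ∣ C d * q := by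
  induction J, hJ using Submodule.fg_induction with
  | singleton x =>
    obtain ⟨d, hd, hx⟩ := h x (Submodule.mem_span_singleton_self x)
    refine ⟨d, hd, fun q hq => ?_⟩
    obtain ⟨a, rfl⟩ := Ideal.mem_span_singleton'.1 hq
    rw [mul_left_comm]
    exact hx.mul_left a
  | sup I J _ _ hI hJ =>
    obtain ⟨d, hd, h1⟩ := hI fun q hq => h q (Submodule.mem_sup_left hq)
    obtain ⟨e, he, h2⟩ := hJ fun q hq => h q (Submodule.mem_sup_right hq)
    refine ⟨d * e, mul_ne_zero hd he, fun q hq => ?_⟩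
    obtain ⟨a, ha, b, hb, rfl⟩ := Submodule.mem_sup.1 hq
    have := dvd_add ((h1 a ha).mul_left (C e)) ((h2 b hb).mul_left (C d))
    convert this using 1
    rw [C_mul]
    ring

theorem le_vClosure {R : Type*} [CommRing R] [IsDomain R]
    {A : FractionalIdeal R⁰ (FractionRing R)} (hA : A⁻¹ ≠ 0) : A ≤ vClosure A := by
  have hA0 : A ≠ 0 := by
    rintro rfl
    exact hA (FractionalIdeal.inv_zero' _)
  intro x hx
  refine (FractionalIdeal.mem_inv_iff hA).2 ?_
  intro y hy
  rw [mul_comm]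
  exact (FractionalIdeal.mem_inv_iff hA0).1 hy x hx

theorem one_mem_inv_of_le_one {R : Type*} [CommRing R] [IsDomain R]
    {A : FractionalIdeal R⁰ (FractionRing R)} (hA0 : A ≠ 0) (hA : A ≤ 1) :
    (1 : FractionRing R) ∈ A⁻¹ := by
  rw [FractionalIdeal.mem_inv_iff hA0]
  intro y hy
  rw [one_mul]
  exact hA hy

theorem inv_ne_zero_of_le_one {R : Type*} [CommRing R] [IsDomain R]
    {A : FractionalIdeal R⁰ (FractionRing R)} (hA0 : A ≠ 0) (hA : A ≤ 1) : A⁻¹ ≠ 0 := fun h0 => by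
  have := one_mem_inv_of_le_one hA0 hA
  rw [h0, FractionalIdeal.mem_zero_iff] at this
  exact one_ne_zero this

theorem mem_tClosure_of_mem {R : Type*} [CommRing R] [IsDomain R] {I : Ideal R} (hI : I ≠ ⊥)
    {x : FractionRing R} (hx : x ∈ (I : FractionalIdeal R⁰ (FractionRing R))) :
    x ∈ tClosure (I : FractionalIdeal R⁰ (FractionRing R)) := by
  obtain ⟨a, haI, rfl⟩ := (FractionalIdeal.mem_coeIdeal _).1 hx
  -- The extra generator b keeps (a, b) nonzero even when a = 0.
  obtain ⟨b, hbI, hb⟩ := Submodule.exists_mem_ne_zero_of_ne_bot hI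
  have hle : Ideal.span {a, b} ≤ I := by
    rw [Ideal.span_le, Set.pair_subset_iff]
    exact ⟨haI, hbI⟩
  have hne : Ideal.span {a, b} ≠ ⊥ := fun h0 => hb (by
    have : b ∈ Ideal.span {a, b} := Ideal.subset_span (by simp)
    rw [h0] at this
    exact this)
  have hne' : ((Ideal.span {a, b} : Ideal R) : FractionalIdeal R⁰ (FractionRing R)) ≠ 0 :=
    FractionalIdeal.coeIdeal_ne_zero.2 hne
  refine ⟨(Ideal.span {a, b} : Ideal R), hne', ?_,
    (FractionalIdeal.coeIdeal_le_coeIdeal _).2 hle,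
    le_vClosure (inv_ne_zero_of_le_one hne' FractionalIdeal.coeIdeal_le_one)
      (FractionalIdeal.mem_coeIdeal_of_mem _ (Ideal.subset_span (by simp)))⟩
  rw [FractionalIdeal.coe_coeIdeal]
  exact (IsLocalization.coeSubmodule_fg (FractionRing R)
    (IsFractionRing.injective R (FractionRing R)) _).2 (Submodule.fg_span (Set.toFinite _))

/-- With f of least degree in Q and a finitely generated J ⊆ Q, some d ≠ 0 has d J ⊆ (f), so d/f ∈
J⁻¹. Any p ∈ J_v then satisfies p d ∈ (f) ⊆ Q, while d ∉ Q. -/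
theorem Polynomial.isTIdeal_of_comap_C_eq_bot {Q : Ideal D[X]} (hQ : Q.IsPrime) (hQ0 : Q ≠ ⊥)
    (hQD : Q.comap (C : D →+* D[X]) = ⊥) : IsTIdeal Q := by
  refine ⟨hQ0, Set.Subset.antisymm ?_ fun x hx => mem_tClosure_of_mem hQ0 hx⟩
  rintro x ⟨J, hJ0, hJfg, hJQ, hx⟩
  have hJ1 : J ≤ 1 := hJQ.trans FractionalIdeal.coeIdeal_le_one
  obtain ⟨J, rfl⟩ := FractionalIdeal.le_one_iff_exists_coeIdeal.1 hJ1
  rw [FractionalIdeal.coe_coeIdeal, IsLocalization.coeSubmodule_fg _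
    (IsFractionRing.injective D[X] (FractionRing D[X]))] at hJfg
  rw [FractionalIdeal.coeIdeal_le_coeIdeal] at hJQ
  obtain ⟨f, hf, hf0, hmin⟩ := exists_minimal_natDegree hQ0
  obtain ⟨d, hd, hdJ⟩ := exists_C_mul_dvd_of_fg hJfg fun q hq =>
    exists_C_mul_dvd_of_minimal_natDegree hf hf0 hmin (hJQ hq)
  have hf0' : algebraMap D[X] (FractionRing D[X]) f ≠ 0 := by simpa using hf0
  have hmem := (FractionalIdeal.mem_inv_iff (inv_ne_zero_of_le_one hJ0 hJ1)).1 hx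
  have hx1 := hmem 1 (one_mem_inv_of_le_one hJ0 hJ1)
  rw [mul_one, FractionalIdeal.mem_one_iff] at hx1
  obtain ⟨p, rfl⟩ := hx1
  have hu : algebraMap D[X] (FractionRing D[X]) (C d) / algebraMap D[X] (FractionRing D[X]) f ∈
      (J : FractionalIdeal D[X]⁰ (FractionRing D[X]))⁻¹ := by
    rw [FractionalIdeal.mem_inv_iff hJ0]
    intro y hy
    obtain ⟨j, hj, rfl⟩ := (FractionalIdeal.mem_coeIdeal _).1 hy
    obtain ⟨e, he⟩ := hdJ j hj
    rw [FractionalIdeal.mem_one_iff]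
    refine ⟨e, ?_⟩
    rw [div_mul_eq_mul_div, ← map_mul, he, map_mul, mul_div_cancel_left₀ _ hf0']
  obtain ⟨e, he⟩ := (FractionalIdeal.mem_one_iff _).1 (hmem _ hu)
  have hpe : p * C d = f * e := by
    apply IsFractionRing.injective D[X] (FractionRing D[X])
    rw [map_mul, map_mul, he]
    field_simp
  refine FractionalIdeal.mem_coeIdeal_of_mem _ ?_
  refine (hQ.mem_or_mem (hpe ▸ Q.mul_mem_right e hf : p * C d ∈ Q)).resolve_right fun h => hd ?_
  have : d ∈ Q.comap (C : D →+* D[X]) := h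
  rwa [hQD] at this

/-- If z d = h and z g = k are polynomials, then h g = d k, so d ∣ h and z is a polynomial. Thus (d,
g)⁻¹ = D[X] and 1 ∈ (d, g)_v. -/
theorem IsTIdeal.eq_top_of_C_mem_of_contentIdeal_eq_top {N : Ideal D[X]} (hN : IsTIdeal N) {d : D}
    (hd : d ≠ 0) (hdN : C d ∈ N) {g : D[X]} (hgN : g ∈ N) (hg : g.contentIdeal = ⊤) : N = ⊤ := by
  rw [Ideal.eq_top_iff_one]
  have hCd : (C d : D[X]) ≠ 0 := by simpa using hd
  have hne' : ((Ideal.span {C d, g} : Ideal D[X]) :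
      FractionalIdeal D[X]⁰ (FractionRing D[X])) ≠ 0 := by
    refine FractionalIdeal.coeIdeal_ne_zero.2 fun h0 => hCd ?_
    have : C d ∈ Ideal.span {C d, g} := Ideal.subset_span (by simp)
    rw [h0] at this
    exact this
  have h1 : (1 : FractionRing D[X]) ∈
      tClosure (N : FractionalIdeal D[X]⁰ (FractionRing D[X])) := by
    refine ⟨(Ideal.span {C d, g} : Ideal D[X]), hne', ?_, ?_, ?_⟩
    · rw [FractionalIdeal.coe_coeIdeal]
      exact (IsLocalization.coeSubmodule_fg _
        (IsFractionRing.injective D[X] (FractionRing D[X])) _).2 (Submodule.fg_span (Set.toFinite _))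
    · rw [FractionalIdeal.coeIdeal_le_coeIdeal, Ideal.span_le, Set.pair_subset_iff]
      exact ⟨hdN, hgN⟩
    · have hinv := inv_ne_zero_of_le_one hne' FractionalIdeal.coeIdeal_le_one
      refine (FractionalIdeal.mem_inv_iff hinv).2 fun z hz => ?_
      rw [FractionalIdeal.mem_inv_iff hne'] at hz
      obtain ⟨h, hh⟩ := (FractionalIdeal.mem_one_iff _).1
        (hz _ (FractionalIdeal.mem_coeIdeal_of_mem _
          (Ideal.subset_span (by simp) : C d ∈ Ideal.span {C d, g})))
      obtain ⟨k, hk⟩ := (FractionalIdeal.mem_one_iff _).1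
        (hz _ (FractionalIdeal.mem_coeIdeal_of_mem _
          (Ideal.subset_span (by simp) : g ∈ Ideal.span {C d, g})))
      have hCd' : algebraMap D[X] (FractionRing D[X]) (C d) ≠ 0 := by simpa using hd
      obtain ⟨e, he⟩ : C d ∣ h := by
        refine C_dvd_of_dvd_mul_of_contentIdeal_eq_top hg ⟨k, ?_⟩
        apply IsFractionRing.injective D[X] (FractionRing D[X])
        rw [map_mul, map_mul, hh, hk]
        ring
      rw [one_mul, FractionalIdeal.mem_one_iff]
      refine ⟨e, mul_right_cancel₀ hCd' ?_⟩
      rw [← hh, he, map_mul, mul_comm]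
  rw [hN.2] at h1
  obtain ⟨p, hp, hp1⟩ := (FractionalIdeal.mem_coeIdeal _).1 h1
  rw [← map_one (algebraMap D[X] (FractionRing D[X]))] at hp1
  rwa [← IsFractionRing.injective D[X] (FractionRing D[X]) hp1]

/-- Over a Prüfer domain Q contains a polynomial of unit content, so a proper t-ideal N above Q has
no nonzero constants. Comparing elements of least degree then gives N = Q. -/
theorem IsPruferDomain.isUMTDomain (h : IsPruferDomain D) : IsUMTDomain D := by
  intro Q hQ hQ0 hQD
  refine ⟨⟨isTIdeal_of_comap_C_eq_bot hQ hQ0 hQD, hQ.ne_top⟩, fun N ⟨hN, hNtop⟩ hQN => ?_⟩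
  have hC : ∀ d : D, C d ∈ Q → d = 0 := fun d hd => by
    have : d ∈ Q.comap (C : D →+* D[X]) := hd
    rwa [hQD] at this
  obtain ⟨f, hf, hf0, hfmin⟩ := exists_minimal_natDegree hQ0
  obtain ⟨g, hgQ, hg⟩ : ∃ g ∈ Q, g.contentIdeal = ⊤ := by
    obtain ⟨g, k, hg, hgk⟩ := h.exists_C_mul_eq_mul (coeff_mem_contentIdeal f f.natDegree)
      (leadingCoeff_ne_zero.2 hf0)
    refine ⟨g, (hQ.mem_or_mem (hgk ▸ Q.mul_mem_right k hf)).resolve_left fun hmem => ?_, hg⟩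
    exact leadingCoeff_ne_zero.2 hf0 (hC _ hmem)
  have hNC : ∀ d : D, C d ∈ N → d = 0 := fun d hd => by
    by_contra hd0
    exact hNtop (hN.eq_top_of_C_mem_of_contentIdeal_eq_top hd0 hd (hQN hgQ) hg)
  obtain ⟨n, hn, hn0, hmin⟩ := exists_minimal_natDegree hN.1
  have hnQ : n ∈ Q := by
    obtain ⟨d, hd, e, he⟩ := exists_C_mul_dvd_of_minimal_natDegree hn hn0 hmin (hQN hf)
    have he0 : e ≠ 0 := by
      rintro rfl
      rw [mul_zero, mul_eq_zero, C_eq_zero] at he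
      exact he.elim hd hf0
    -- If e were in Q, then deg e ≥ deg f = deg n + deg e would make n a nonzero constant of N.
    refine (hQ.mem_or_mem (he ▸ Q.mul_mem_left _ hf)).resolve_right fun heQ => ?_
    have hdeg := congrArg natDegree he
    rw [natDegree_C_mul hd, natDegree_mul hn0 he0] at hdeg
    have hle := hfmin e heQ he0
    obtain ⟨a, rfl⟩ := natDegree_eq_zero.1 (by lia : n.natDegree = 0)
    exact hn0 (by rw [hNC a hn, C_0])
  intro q hq
  obtain ⟨d, hd, e, he⟩ := exists_C_mul_dvd_of_minimal_natDegree hn hn0 hmin hq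
  exact (hQ.mem_or_mem (he ▸ Q.mul_mem_right e hnQ : C d * q ∈ Q)).resolve_left fun hmem =>
    hd (hC d hmem)

end UMT

/-! ### Valuation elements of the Nagata ring -/

section Factorization

theorem Polynomial.contentIdeal_pow_le {R : Type*} [CommRing R] (f : R[X]) (n : ℕ) :
    (f ^ n).contentIdeal ≤ f.contentIdeal ^ n := by
  induction n with
  | zero => simp
  | succ n ih =>
    rw [pow_succ, pow_succ]
    exact (contentIdeal_mul_le_mul_contentIdeal _ _).trans (Ideal.mul_mono_left ih)

/-- The comaximal factors of a principal ideal are invertible, hence finitely generated, hence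
principal. -/
theorem IsHLocalDomain.isVFD_of_isBezout {R : Type*} [CommRing R] [IsDomain R] [IsBezout R]
    (hl : IsHLocalDomain R) : IsVFD R := by
  intro a ha hau
  obtain ⟨n, I, hn, hI, hco, hinf, htop⟩ := hl.exists_comaximal_valuationIdeals
    IsBezout.isPruferDomain (J := Ideal.span {a}) (by simpa using ha)
  rw [Ideal.iInf_eq_prod_of_pairwise_sup_eq_top hco] at hinf
  have hex : ∀ i, ∃ v : R, I i = Ideal.span {v} := fun i => by
    have hinv : IsInvertibleIdeal (I i) := (isInvertibleIdeal_span_singleton ha).of_dvd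
      (hinf ▸ Finset.dvd_prod_of_mem I (Finset.mem_univ i))
    exact (IsBezout.isPrincipal_of_FG (I i) hinv.fg).1
  choose v hv using hex
  have hprod : Ideal.span {∏ i, v i} = Ideal.span {a} := by
    rw [hinf, ← Ideal.prod_span_singleton]
    exact Finset.prod_congr rfl fun i _ => (hv i).symm
  obtain ⟨u, hu⟩ := Ideal.span_singleton_eq_span_singleton.1 hprod
  have hval : ∀ i, IsValuationElement (v i) := fun i => by
    refine ⟨?_, ?_, hv i ▸ hI i⟩
    · intro h0
      rw [Finset.prod_eq_zero (Finset.mem_univ i) h0, zero_mul] at hu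
      exact ha hu.symm
    · intro hui
      refine htop (fun h => hau (Ideal.span_singleton_eq_top.1 h)) i ?_
      rw [hv i, Ideal.span_singleton_eq_top]
      exact hui
  -- The generators multiply to a only up to a unit, which is absorbed into one factor.
  let i₀ : Fin n := ⟨0, hn⟩
  have hspan : Ideal.span {v i₀ * u} = Ideal.span {v i₀} :=
    Ideal.span_singleton_mul_right_unit u.isUnit _
  refine ⟨n, Function.update v i₀ (v i₀ * u), hn, fun i => ?_, ?_⟩
  · by_cases hi : i = i₀
    · subst hi
      rw [Function.update_self]
      obtain ⟨h1, h2, h3⟩ := hval i₀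
      exact ⟨mul_ne_zero h1 u.ne_zero, fun h => h2 (isUnit_of_mul_isUnit_left h), hspan ▸ h3⟩
    · rw [Function.update_of_ne hi]
      exact hval i
  · rw [Finset.prod_update_of_mem (Finset.mem_univ _), mul_right_comm,
      ← Finset.erase_eq, Finset.mul_prod_erase _ _ (Finset.mem_univ _), hu]

variable {D : Type*} [CommRing D] [IsDomain D]

/-- A polynomial that generates a valuation ideal of the Nagata ring, with content in `P`. -/
theorem IsVFD.exists_contentIdeal_le (h : IsVFD (NagataRing D)) {P : Ideal D} (hP : P.IsPrime)
    (hP0 : P ≠ ⊥) : ∃ f : D[X], f ≠ 0 ∧ f.contentIdeal ≤ P ∧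
      IsValuationIdeal (Ideal.span {algebraMap D[X] (NagataRing D) f}) := by
  obtain ⟨p, hp, hp0⟩ := Submodule.exists_mem_ne_zero_of_ne_bot hP0
  have hpP := algebraMap_C_mem_nagataExtension hp
  have hprime := nagataExtension_isPrime hP
  obtain ⟨n, v, -, hv, hprod⟩ := h (algebraMap D[X] (NagataRing D) (C p))
    (by rwa [Ne, map_eq_zero_iff _ NagataRing.algebraMap_injective, C_eq_zero])
    (fun hu => hprime.ne_top (Ideal.eq_top_of_isUnit_mem _ hpP hu))
  rw [hprod, hprime.prod_mem_iff] at hpP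
  obtain ⟨i, -, hi⟩ := hpP
  obtain ⟨f, hf⟩ := NagataRing.exists_associated_algebraMap (v i)
  refine ⟨f, ?_, (algebraMap_mem_nagataExtension_iff hP).1
    (Ideal.mem_of_dvd _ hf.symm.dvd hi), ?_⟩
  · rintro rfl
    rw [map_zero] at hf
    exact (hv i).1 ((associated_zero_iff_eq_zero _).1 hf.symm)
  · rw [Ideal.span_singleton_eq_span_singleton.2 hf]
    exact (hv i).2.2

theorem Polynomial.C_dvd_C_mul_pow_of_forall_mem_contentIdeal_pow {R : Type*} [CommRing R]
    {f : R[X]} {n : ℕ} {x y : R}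
    (h : ∀ e ∈ f.contentIdeal ^ n, y ∣ x * e) : C y ∣ C x * f ^ n := by
  rw [C_dvd_iff_dvd_coeff]
  intro m
  rw [coeff_C_mul]
  exact h _ (contentIdeal_pow_le f n (coeff_mem_contentIdeal _ m))

/-- The cancellation argument runs in D(X) with the ideal (f). Since c(fⁿ) ⊆ c(f)ⁿ, divisibility of
s x c(f)ⁿ by y in D gives divisibility of s x fⁿ by y, and the resulting y ∣ s x in D(X) descends to
D. -/
theorem IsTreedDomain.isPruferDomain_of_isVFD_nagataRing (hT : IsTreedDomain D)
    (h : IsVFD (NagataRing D)) : IsPruferDomain D := by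
  refine isPruferDomain_of_forall_isMaximal fun M hM x y => ?_
  by_contra! hcon
  obtain ⟨P, hP, hP0, hPI⟩ := hT.exists_prime_forall_fg hM (fun s hs => (hcon s hs).1)
    (fun s hs => (hcon s hs).2)
  obtain ⟨f, hf0, hfP, hfV⟩ := h.exists_contentIdeal_le hP hP0
  obtain ⟨V, hV⟩ := isValuationIdeal_iff.1 hfV
  have hinv : IsInvertibleIdeal (Ideal.span {algebraMap D[X] (NagataRing D) f}) :=
    isInvertibleIdeal_span_singleton
      (by rwa [Ne, map_eq_zero_iff _ NagataRing.algebraMap_injective])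
  obtain ⟨⟨s, hs, n, hn⟩, t, ht, m, hm⟩ := hPI _ (contentIdeal_FG f) hfP
  let ι : D →+* NagataRing D := (algebraMap D[X] (NagataRing D)).comp C
  have hι : Function.Injective ι := NagataRing.algebraMap_injective.comp C_injective
  have hdvd : ∀ {x y : D}, ι y ∣ ι x → y ∣ x := fun {x y} hxy => by
    have : x ∈ (C y).contentIdeal := NagataRing.mem_contentIdeal_of_algebraMap_dvd hxy
    rwa [contentIdeal_C, Ideal.mem_span_singleton] at this
  have key : ∀ {x y s : D} {n : ℕ}, y ≠ 0 → (∀ e ∈ f.contentIdeal ^ n, y ∣ s * x * e) →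
      algebraMap _ (FractionRing (NagataRing D)) (ι x) / algebraMap _ _ (ι y) ∈ V →
      y ∣ s * x := by
    intro x y s n hy hn hz
    have hιy : ι y ≠ 0 := by rwa [Ne, map_eq_zero_iff _ hι]
    have hιy' : algebraMap _ (FractionRing (NagataRing D)) (ι y) ≠ 0 := by simpa using hιy
    apply hdvd
    rw [map_mul]
    refine hV.dvd_mul_of_forall_mem_pow hinv hz (by field_simp) hιy (n := n) fun e he => ?_
    rw [Ideal.span_singleton_pow, Ideal.mem_span_singleton] at he
    refine (?_ : ι y ∣ _).trans (mul_dvd_mul_left _ he)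
    rw [← map_mul, ← map_pow]
    change algebraMap _ _ (C y) ∣ algebraMap D[X] (NagataRing D) (C (s * x)) * _
    rw [← map_mul]
    exact map_dvd _ (C_dvd_C_mul_pow_of_forall_mem_contentIdeal_pow hn)
  have hx0 : x ≠ 0 := by
    rintro rfl
    exact (hcon s hs).1 (by simp)
  have hy0 : y ≠ 0 := by
    rintro rfl
    exact (hcon s hs).2 (by simp)
  rcases V.mem_or_inv_mem (algebraMap _ (FractionRing (NagataRing D)) (ι x) /
    algebraMap _ _ (ι y)) with hz | hz
  · exact (hcon s hs).1 (key hy0 hn hz)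
  · rw [inv_div] at hz
    exact (hcon t ht).2 (key hx0 hm hz)

/-- For Prüfer D one has c(f) = f D(X) ∩ D, so the valuation ring for f, pulled back to the quotient
field of D, works for c(f). -/
theorem IsPruferDomain.isValuationIdeal_contentIdeal (h : IsPruferDomain D) {f : D[X]}
    (hf : IsValuationIdeal (Ideal.span {algebraMap D[X] (NagataRing D) f})) :
    IsValuationIdeal f.contentIdeal := by
  obtain ⟨W, hW, hfW⟩ := isValuationIdeal_iff.1 hf
  let ι : D →+* NagataRing D := (algebraMap D[X] (NagataRing D)).comp C
  have hι : Function.Injective ι := NagataRing.algebraMap_injective.comp C_injective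
  have hκ : Function.Injective ((algebraMap (NagataRing D) (FractionRing (NagataRing D))).comp ι) :=
    (IsFractionRing.injective (NagataRing D) (FractionRing (NagataRing D))).comp hι
  let κ : FractionRing D →+* FractionRing (NagataRing D) := IsFractionRing.lift hκ
  have hκι : ∀ d : D, κ (algebraMap D (FractionRing D) d) = algebraMap _ _ (ι d) := fun d =>
    IsFractionRing.lift_algebraMap hκ d
  refine isValuationIdeal_iff.2 ⟨W.comap κ, fun d => ?_, fun i hi d v hv hd => ?_⟩
  · rw [ValuationSubring.mem_comap, hκι]
    exact hW _
  · obtain ⟨r, hr⟩ := h.algebraMap_dvd_algebraMap_C hi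
    refine NagataRing.mem_contentIdeal_of_algebraMap_dvd (Ideal.mem_span_singleton.1 ?_)
    refine hfW _ (Ideal.mem_span_singleton_self _) _ (algebraMap _ _ r * κ v)
      (W.mul_mem _ _ (hW r) hv) ?_
    have h1 := congrArg κ hd
    rw [map_mul, hκι, hκι] at h1
    change algebraMap _ (FractionRing (NagataRing D)) (ι d) = _
    rw [h1, ← mul_assoc, ← map_mul, ← hr]
    rfl

theorem IsPruferDomain.primesContainInvertibleValuationIdeals (h : IsPruferDomain D)
    (hv : IsVFD (NagataRing D)) : PrimesContainInvertibleValuationIdeals D := by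
  intro P hP hP0
  obtain ⟨f, hf0, hfP, hfV⟩ := hv.exists_contentIdeal_le hP hP0
  exact ⟨f.contentIdeal, hfP,
    h _ (fun h0 => hf0 ((contentIdeal_eq_bot_iff f).1 h0)) (contentIdeal_FG f),
    h.isValuationIdeal_contentIdeal hfV⟩

end Factorization

end

/-! ### The equivalences -/

theorem corollary4p7 (D : Type*) [CommRing D] [IsDomain D] (hD : IsTreedDomain D) :
    [ IsHLocalDomain D ∧ IsPruferDomain D,
      IsVIFD D,
      ∀ J : Ideal D, J ≠ ⊥ → IsProductOfValuationIdeals J,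
      ∀ a : D, a ≠ 0 → IsProductOfComaximalValuationIdeals (Ideal.span {a}),
      ∀ a : D, a ≠ 0 → IsIntersectionOfComaximalValuationIdeals (Ideal.span {a}),
      ∀ P : Ideal D, P.IsPrime → P ≠ ⊥ →
        ∃ I : Ideal D, I ≤ P ∧ IsInvertibleIdeal I ∧ IsValuationIdeal I,
      IsVFD (NagataRing D) ∧ IsUMTDomain D ].TFAE := by
  tfae_have 1 → 3 := by
    rintro ⟨hl, hP⟩ J hJ
    obtain ⟨n, I, hn, hI, hco, hinf, -⟩ := hl.exists_comaximal_valuationIdeals hP hJ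
    exact ⟨n, I, hn, hI, hinf.trans (Ideal.iInf_eq_prod_of_pairwise_sup_eq_top hco)⟩
  tfae_have 3 → 2 := fun h a ha => h _ (by simpa using ha)
  tfae_have 1 → 5 := by
    rintro ⟨hl, hP⟩ a ha
    obtain ⟨n, I, hn, hI, hco, hinf, -⟩ :=
      hl.exists_comaximal_valuationIdeals hP (J := Ideal.span {a}) (by simpa using ha)
    exact ⟨n, I, hn, hI, hco, hinf⟩
  tfae_have 5 → 4 := by
    intro h a ha
    obtain ⟨n, I, hn, hI, hco, hinf⟩ := h a ha
    exact ⟨n, I, hn, hI, hco, hinf.trans (Ideal.iInf_eq_prod_of_pairwise_sup_eq_top hco)⟩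
  tfae_have 4 → 2 := by
    intro h a ha
    obtain ⟨n, I, hn, hI, -, hprod⟩ := h a ha
    exact ⟨n, I, hn, hI, hprod⟩
  tfae_have 2 → 6 :=
    IsProductOfValuationIdeals.primesContainInvertibleValuationIdeals
  tfae_have 6 → 1 := fun h =>
    ⟨(hD.isPruferDomain h).isHLocalDomain h, hD.isPruferDomain h⟩
  tfae_have 1 → 7 := by
    rintro ⟨hl, hP⟩
    have := hP.isBezout_nagataRing
    exact ⟨(hl.nagataRing hP).isVFD_of_isBezout, hP.isUMTDomain⟩
  tfae_have 7 → 6 := fun ⟨hv, _⟩ =>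
    (hD.isPruferDomain_of_isVFD_nagataRing hv).primesContainInvertibleValuationIdeals hv
  tfae_finish
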